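/- Let $\mathbb M=\mathbb R^4$ be Minkowski space with $k^2=k_0^2-|\mathbf k|^2$, $\mathbf k=(k_1,k_2,k_3)$, let $k\!\!/=\gamma^\mu k_\mu$ with the $4\times4$ Dirac matrices $\gamma^\mu$, and let $q\in\mathbb M$ be spacelike, $q^2<0$. The one-loop and two-loop Mellin transforms of massless Yukawa theory are $$F_1(\rho)=-\int_{\mathbb M}\frac{d^4k}{i\pi^2}\,\frac{1}{k^2(k-q)^2}\left(\frac{k^2}{q^2}\right)^{-\rho},$$ $$F_2(\rho)=\int_{\mathbb M}\frac{d^4k}{i\pi^2}\int_{\mathbb M}\frac{d^4l}{i\pi^2}\,\frac{l\!\!/(k\!\!/+q\!\!/)}{(k+l)^2\,l^2\,(k+q)^2\,k^2\,(l-q)^2}\left(\frac{(l+k)^2}{q^2}\right)^{-\rho}.$$ The integrals are understood with Feynman's $+i0$ prescription: in the denominators and under the complex powers (principal branch) each square $p^2$ of a momentum $p$ containing $k$ or $l$ is replaced by $p^2+i\varepsilon|\mathbf p|^2$, $\varepsilon>0$, while $q^2$ is kept, and the limit $\varepsilon\to0^+$ of the resulting integrals over $\mathbb M$ and $\mathbb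 M\times\mathbb M$ is taken. Theorem. For $0<\operatorname{Re}\rho<1$ and every spacelike $q$ these integrals converge absolutely for each $\varepsilon>0$, and their limits as $\varepsilon\to0^+$ exist; the limits do not depend on $q$, and the limit of the matrix-valued two-loop integral is a scalar multiple of the unit matrix. The resulting scalar functions $F_1,F_2$ are holomorphic on the strip $0<\operatorname{Re}\rho<1$ and satisfy $$F_i(\rho)=F_i(1-\rho),\qquad i=1,2.$$ The same identity holds for every holomorphic continuation of $F_i$ to a connected open set that contains the strip and is mapped to itself by $\rho\mapsto1-\rho$. Moreover $F_1(\rho)=-\dfrac{1}{\rho(1-\rho)}$ for $0<\operatorname{Re}\rho<1$. -/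

import Mathlib

open MeasureTheory Filter Topology

noncomputable section

/-- Four-dimensional Minkowski momentum space, in coordinates `(k₀, k₁, k₂, k₃)`,
with Lebesgue measure `d⁴k`. -/
abbrev Momentum : Type := Fin 4 → ℝ

/-- The squared length of the spatial part, `k₁² + k₂² + k₃²`. -/
def spatialSq (k : Momentum) : ℝ := k 1 ^ 2 + k 2 ^ 2 + k 3 ^ 2

/-- The Minkowski square `k² = k₀² - k₁² - k₂² - k₃²`. -/
def minkSq (k : Momentum) : ℝ := k 0 ^ 2 - spatialSq k

/-- The Minkowski square with Feynman's `+i0` prescription before the limit `ε → 0⁺`, in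
Zimmermann's form `k² + iε |𝐤|²`, for which massless Feynman integrals over Minkowski space
converge absolutely as long as `ε > 0`. -/
def feynSq (ε : ℝ) (k : Momentum) : ℂ := (minkSq k : ℂ) + Complex.I * (ε * spatialSq k : ℝ)

/-- The Dirac matrices `γ⁰, γ¹, γ², γ³` in the Dirac representation. -/
def diracGamma : Fin 4 → Matrix (Fin 4) (Fin 4) ℂ :=
  ![!![1, 0, 0, 0; 0, 1, 0, 0; 0, 0, -1, 0; 0, 0, 0, -1],
    !![0, 0, 0, 1; 0, 0, 1, 0; 0, -1, 0, 0; -1, 0, 0, 0],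
    !![0, 0, 0, -Complex.I; 0, 0, Complex.I, 0; 0, Complex.I, 0, 0; -Complex.I, 0, 0, 0],
    !![0, 0, 1, 0; 0, 0, 0, -1; -1, 0, 0, 0; 0, 1, 0, 0]]

/-- Feynman slash `γ^μ k_μ = γ⁰ k₀ - γ¹ k₁ - γ² k₂ - γ³ k₃`, where `k` lists the contravariant
components. -/
def slash (k : Momentum) : Matrix (Fin 4) (Fin 4) ℂ :=
  (k 0 : ℂ) • diracGamma 0 - (k 1 : ℂ) • diracGamma 1
    - (k 2 : ℂ) • diracGamma 2 - (k 3 : ℂ) • diracGamma 3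

/-- The Clifford relation `k̸ k̸ = k²`. -/
theorem slash_mul_self (k : Momentum) :
    slash k * slash k = (minkSq k : ℂ) • (1 : Matrix (Fin 4) (Fin 4) ℂ) := by
  ext i j
  fin_cases i <;> fin_cases j <;>
    simp [slash, diracGamma, minkSq, spatialSq, Matrix.mul_apply, Fin.sum_univ_four] <;>
    ring_nf <;> simp <;> ring

/-- `HasMinkowskiIntegral f v`: the integrands `f ε`, regularised by the `+i0` prescription at
`ε > 0`, are absolutely integrable and their integrals converge to `v` as `ε → 0⁺`. -/
def HasMinkowskiIntegral {X : Type*} [MeasureSpace X] (f : ℝ → X → ℂ) (v : ℂ) : Prop :=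
  (∀ ε : ℝ, 0 < ε → Integrable (f ε) volume) ∧
    Tendsto (fun ε : ℝ => ∫ x, f ε x) (𝓝[>] 0) (𝓝 v)

/-- The regularised integrand of the one-loop Mellin transform, including the normalisation
`1 / (iπ²)` of the measure:
`-(1 / (iπ²)) · 1 / (k² (k - q)²) · (k² / q²)^(-ρ)`. -/
def oneLoopIntegrand (q : Momentum) (ρ : ℂ) (ε : ℝ) (k : Momentum) : ℂ :=
  -(1 / (Complex.I * (Real.pi : ℂ) ^ 2)) *
    (1 / (feynSq ε k * feynSq ε (k - q))) *
    (feynSq ε k / (minkSq q : ℂ)) ^ (-ρ)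

/-- The regularised, matrix-valued integrand of the two-loop Mellin transform at the pair of loop
momenta `x = (k, l)`, including the normalisation `1 / (iπ²)` of both measures:
`(1 / (iπ²))² · l̸ (k̸ + q̸) / ((k + l)² l² (k + q)² k² (l - q)²) · ((l + k)² / q²)^(-ρ)`. -/
def twoLoopIntegrand (q : Momentum) (ρ : ℂ) (ε : ℝ) (x : Momentum × Momentum) :
    Matrix (Fin 4) (Fin 4) ℂ :=
  ((1 / (Complex.I * (Real.pi : ℂ) ^ 2)) ^ 2 *
    (1 / (feynSq ε (x.1 + x.2) * feynSq ε x.2 * feynSq ε (x.1 + q) * feynSq ε x.1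
      * feynSq ε (x.2 - q))) *
    (feynSq ε (x.2 + x.1) / (minkSq q : ℂ)) ^ (-ρ)) •
    (slash x.2 * (slash x.1 + slash q))

/-- `z` is the value at `ρ` of the one-loop Mellin transform with external momentum `q`. -/
def IsOneLoopMellin (q : Momentum) (ρ z : ℂ) : Prop :=
  HasMinkowskiIntegral (oneLoopIntegrand q ρ) z

/-- `z` is the value at `ρ` of the two-loop Mellin transform with external momentum `q`: the
matrix-valued integral over pairs of momenta, taken entrywise, is `z` times the unit matrix. -/
def IsTwoLoopMellin (q : Momentum) (ρ z : ℂ) : Prop :=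
  ∀ a b : Fin 4, HasMinkowskiIntegral (fun ε x => twoLoopIntegrand q ρ ε x a b)
    ((z • (1 : Matrix (Fin 4) (Fin 4) ℂ)) a b)

/-- The strip `0 < Re ρ < 1`, on which the integrals of both Mellin transforms converge. -/
def mellinStrip : Set ℂ := {ρ : ℂ | 0 < ρ.re ∧ ρ.re < 1}

/-- Invariance of a function `F`, given on the strip, under `ρ ↦ 1 - ρ`: on the strip itself, and
for every holomorphic continuation of `F` to a connected open set that is mapped to itself by
`ρ ↦ 1 - ρ`. -/
def IsReflectionInvariant (F : ℂ → ℂ) : Prop :=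
  (∀ ρ ∈ mellinStrip, F ρ = F (1 - ρ)) ∧
    ∀ (U : Set ℂ) (g : ℂ → ℂ), IsOpen U → IsPreconnected U → mellinStrip ⊆ U →
      (∀ ρ ∈ U, 1 - ρ ∈ U) → DifferentiableOn ℂ g U → Set.EqOn g F mellinStrip →
        ∀ ρ ∈ U, g ρ = g (1 - ρ)

end

/-! The Minkowski integrals are obtained from Euclidean ones by analytic continuation in the metric.
The form k₀² + a|𝐤|² is the regularised Minkowski square for a = -1 + iε; for a = r² > 0 it is the
Euclidean square after dilating space by r. On the slit plane its modulus dominates a multiple of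
the Euclidean square, locally uniformly in a (`exists_metricSq_bound`). Hence both integrals
converge absolutely and are holomorphic in a, and the identity theorem carries the Euclidean
formulas to a = -1 + iε (`integral_metricLoop`, `integral_metricKite_mul_slashNumerator`). The limit
ε → 0⁺ is then taken in an explicit expression, where the phase created by dividing by the negative
number q² cancels the power of q².

The one-loop Euclidean integral is a chain of two propagators, computed with Schwinger parameters
(`lintegral_prop_mul_prop`).

At two loops, exchanging the fermion lines replaces the numerator by half an anticommutator, which
is a scalar by the Clifford relation. Rotation invariance reduces the remaining tensor integral to
two functions of ρ, and the combination surviving the limit is its Euclidean trace, with numerator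
⟨l, q - k⟩. For |q| = 1, 2⟨l, q - k⟩ = 1 + |l - k|² - |k|² - |l - q|². The last two terms cancel a
propagator each and leave iterated chains, symmetric under s ↦ 1 - s; the first two give the scalar
kite K with exponents 1 + s and s on its middle line.

The reflection thus follows from K(α) = K(2 - α) at unit q (`kite_two_sub_timeVec`). Joining the
external vertices of the kite by a line of exponent 2 - α gives the complete graph on four vertices
with a scale-invariant integrand, in which the lines α and 2 - α are opposite edges; a relabelling
of vertices swaps them. The logarithmic divergence of the closed graph is removed by restricting to
a window of scales, and the result does not depend on how scale is measured
(`lintegral_scaleWindow_eq`). These identities hold at real s; holomorphy in ρ extends the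
reflection to the strip. -/

open scoped ENNReal InnerProductSpace

noncomputable section

/-! ### Holomorphic parameter integrals and the identity theorem -/

/-- A dominated parameter integral of holomorphic functions is holomorphic. -/
theorem differentiableOn_integral_of_dominated {X : Type*} [MeasurableSpace X] {μ : Measure X}
    {U : Set ℂ} (hU : IsOpen U) {F : ℂ → X → ℂ}
    (hmeas : ∀ z ∈ U, AEStronglyMeasurable (F z) μ)
    (hdiff : ∀ x, DifferentiableOn ℂ (fun z => F z x) U)
    (hbound : ∀ z₀ ∈ U, ∃ bound : X → ℝ, Integrable bound μ ∧
      ∀ᶠ z in 𝓝 z₀, ∀ x, ‖F z x‖ ≤ bound x) :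
    DifferentiableOn ℂ (fun z => ∫ x, F z x ∂μ) U := by
  intro z₀ hz₀
  obtain ⟨bound, hbi, hb⟩ := hbound z₀ hz₀
  obtain ⟨r, hr, hball⟩ := Metric.eventually_nhds_iff_ball.1 (hb.and (hU.mem_nhds hz₀))
  have hd : ∀ x, ∀ z ∈ Metric.ball z₀ r, DifferentiableAt ℂ (fun z => F z x) z := fun x z hz =>
    (hdiff x).differentiableAt (hU.mem_nhds (hball z hz).2)
  have hmem : ∀ z ∈ Metric.ball z₀ (r / 2), ∀ w ∈ Metric.closedBall z (r / 2),
      w ∈ Metric.ball z₀ r := by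
    intro z hz w hw
    rw [Metric.mem_ball] at *
    rw [Metric.mem_closedBall] at hw
    linarith [dist_triangle w z z₀]
  have hr2 : 0 < r / 2 := half_pos hr
  have hz₀r : z₀ ∈ Metric.ball z₀ r := Metric.mem_ball_self hr
  refine DifferentiableAt.differentiableWithinAt ?_
  have key := hasDerivAt_integral_of_dominated_loc_of_deriv_le (μ := μ) (F := F)
    (F' := fun z x => deriv (fun z => F z x) z) (x₀ := z₀) (s := Metric.ball z₀ (r / 2))
    (bound := fun x => bound x / (r / 2)) (Metric.ball_mem_nhds _ hr2)
    (by filter_upwards [Metric.ball_mem_nhds z₀ hr] with z hz using hmeas z (hball z hz).2)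
    (hbi.mono' (hmeas z₀ hz₀) (Eventually.of_forall (hball z₀ hz₀r).1)) ?_ ?_
    (hbi.div_const _) ?_
  · exact key.2.differentiableAt
  · -- the derivative is a limit of difference quotients
    obtain ⟨u, hu0, hu⟩ : ∃ u : ℕ → ℂ, (∀ n, u n ≠ 0 ∧ z₀ + u n ∈ U) ∧
        Tendsto u atTop (𝓝 0) := by
      refine ⟨fun n => ((r / 2 / (n + 1) : ℝ) : ℂ), fun n => ⟨?_, (hball _ ?_).2⟩, ?_⟩
      · exact Complex.ofReal_ne_zero.2 (by positivity)
      · simp only [Metric.mem_ball, dist_self_add_left, Complex.norm_real, Real.norm_eq_abs]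
        rw [abs_of_pos (by positivity)]
        calc r / 2 / ((n : ℝ) + 1) ≤ r / 2 := div_le_self hr2.le (by simp)
          _ < r := half_lt_self hr
      · have := (tendsto_one_div_add_atTop_nhds_zero_nat (𝕜 := ℝ)).const_mul (r / 2)
        have h2 := (Complex.continuous_ofReal.tendsto _).comp this
        simpa [Function.comp_def, div_eq_mul_inv] using h2
    refine aestronglyMeasurable_of_tendsto_ae (u := atTop)
      (f := fun n x => (u n)⁻¹ • (F (z₀ + u n) x - F z₀ x)) ?_ ?_
    · exact fun n => ((hmeas _ (hu0 n).2).sub (hmeas _ hz₀)).const_smul (u n)⁻¹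
    · refine Eventually.of_forall fun x => ?_
      have h1 := (hd x z₀ hz₀r).hasDerivAt.tendsto_slope_zero
      exact h1.comp (tendsto_nhdsWithin_iff.2 ⟨hu, Eventually.of_forall fun n => (hu0 n).1⟩)
  · refine Eventually.of_forall fun x z hz => ?_
    -- Cauchy's estimate on circles of radius `r / 2` turns the bound on the functions into one on
    -- their derivatives.
    refine Complex.norm_deriv_le_of_forall_mem_sphere_norm_le hr2 ?_ ?_
    · refine DifferentiableOn.diffContOnCl fun w hw => ?_
      refine (hd x w (hmem z hz w ?_)).differentiableWithinAt
      exact Metric.closure_ball_subset_closedBall hw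
    · exact fun w hw => (hball w (hmem z hz w (Metric.sphere_subset_closedBall hw))).1 x
  · refine Eventually.of_forall fun x z hz => ?_
    exact (hd x z (hmem z hz z (Metric.mem_closedBall_self hr2.le))).hasDerivAt

/-- Two holomorphic functions on a connected open set which agree at all real points of a
neighbourhood of one real point agree everywhere. -/
theorem eqOn_of_eqOn_real {U : Set ℂ} (hU : IsOpen U) (hc : IsPreconnected U) {f g : ℂ → ℂ}
    (hf : DifferentiableOn ℂ f U) (hg : DifferentiableOn ℂ g U) {x₀ : ℝ} (hx₀ : (x₀ : ℂ) ∈ U)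
    (h : ∀ᶠ x : ℝ in 𝓝 x₀, f x = g x) : Set.EqOn f g U := by
  refine (hf.analyticOnNhd hU).eqOn_of_preconnected_of_frequently_eq (hg.analyticOnNhd hU) hc hx₀ ?_
  have h1 : ∃ᶠ x : ℝ in 𝓝[≠] x₀, f x = g x :=
    (h.filter_mono nhdsWithin_le_nhds).frequently
  have h2 : Tendsto (fun x : ℝ => (x : ℂ)) (𝓝[≠] x₀) (𝓝[≠] (x₀ : ℂ)) :=
    tendsto_nhdsWithin_iff.2 ⟨(Complex.continuous_ofReal.tendsto x₀).mono_left nhdsWithin_le_nhds,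
      by filter_upwards [self_mem_nhdsWithin] with x hx using by simpa using hx⟩
  exact h2.frequently h1

theorem isOpen_mellinStrip : IsOpen mellinStrip :=
  (isOpen_lt continuous_const Complex.continuous_re).inter
    (isOpen_lt Complex.continuous_re continuous_const)

theorem isPreconnected_mellinStrip : IsPreconnected mellinStrip :=
  ((convex_halfSpace_re_gt 0).inter (convex_halfSpace_re_lt 1)).isPreconnected

theorem one_sub_mem_mellinStrip {ρ : ℂ} (h : ρ ∈ mellinStrip) : 1 - ρ ∈ mellinStrip := by
  simp only [mellinStrip, Set.mem_ofPred_eq, Complex.sub_re, Complex.one_re] at *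
  constructor <;> linarith

theorem half_mem_mellinStrip : ((1 / 2 : ℝ) : ℂ) ∈ mellinStrip := by
  norm_num [mellinStrip]

/-- A holomorphic function on the strip that is invariant under reflection at real points is
reflection invariant. -/
theorem isReflectionInvariant_of_real {F : ℂ → ℂ} (hF : DifferentiableOn ℂ F mellinStrip)
    (h : ∀ s : ℝ, 0 < s → s < 1 → F s = F (1 - s : ℝ)) : IsReflectionInvariant F := by
  have hstrip : Set.EqOn F (fun ρ => F (1 - ρ)) mellinStrip := by
    refine eqOn_of_eqOn_real isOpen_mellinStrip isPreconnected_mellinStrip hF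
      (hF.comp (by fun_prop) fun ρ hρ => one_sub_mem_mellinStrip hρ) half_mem_mellinStrip ?_
    filter_upwards [Ioo_mem_nhds (by norm_num : (0 : ℝ) < 1 / 2) (by norm_num : (1 / 2 : ℝ) < 1)]
      with s hs
    simpa using h s hs.1 hs.2
  refine ⟨hstrip, fun U g hU hUc hsub hinv hg hgF ρ hρ => ?_⟩
  have h2 : DifferentiableOn ℂ (fun ρ => g (1 - ρ)) U := hg.comp (by fun_prop) hinv
  refine eqOn_of_eqOn_real hU hUc hg h2 (hsub half_mem_mellinStrip) ?_ hρ
  filter_upwards [Ioo_mem_nhds (by norm_num : (0 : ℝ) < 1 / 2) (by norm_num : (1 / 2 : ℝ) < 1)]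
    with s hs
  have hs' : (s : ℂ) ∈ mellinStrip := by simpa [mellinStrip] using hs
  rw [hgF hs', hgF (one_sub_mem_mellinStrip hs'), hstrip hs']

/-! ### The Euclidean chain integral -/

/-- Euclidean momentum space. -/
abbrev EMomentum : Type := EuclideanSpace ℝ (Fin 4)

theorem lintegral_comp_smul_addHaar {V : Type*} [NormedAddCommGroup V] [NormedSpace ℝ V]
    [MeasurableSpace V] [BorelSpace V] [FiniteDimensional ℝ V] (μ : Measure V)
    [μ.IsAddHaarMeasure] (f : V → ℝ≥0∞) {c : ℝ} (hc : 0 < c) :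
    ∫⁻ x, f x ∂μ = ENNReal.ofReal (c ^ Module.finrank ℝ V) * ∫⁻ x, f (c • x) ∂μ := by
  have h : ∫⁻ x, f (c • x) ∂μ = ∫⁻ x, f x ∂(μ.map (c • ·)) :=
    ((Homeomorph.smulOfNeZero c hc.ne').isClosedEmbedding.measurableEmbedding.lintegral_map f).symm
  rw [h, Measure.map_addHaar_smul μ hc.ne', lintegral_smul_measure, smul_eq_mul, ← mul_assoc,
    ← ENNReal.ofReal_mul (by positivity), abs_of_pos (by positivity),
    mul_inv_cancel₀ (by positivity), ENNReal.ofReal_one, one_mul]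

theorem lintegral_Ioi_comp_mul (f : ℝ → ℝ≥0∞) {c : ℝ} (hc : 0 < c) :
    ∫⁻ x in Set.Ioi 0, f x = ENNReal.ofReal c * ∫⁻ x in Set.Ioi 0, f (c * x) := by
  rw [← lintegral_indicator measurableSet_Ioi, ← lintegral_indicator measurableSet_Ioi,
    lintegral_comp_smul_addHaar volume _ hc]
  simp only [Module.finrank_self, pow_one, smul_eq_mul]
  congr 1
  refine lintegral_congr fun x => ?_
  simp only [Set.indicator, Set.mem_Ioi, mul_pos_iff_of_pos_left hc]

/-- The Euclidean propagator `(‖x‖²)^(-s)`. -/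
def prop (s : ℝ) (x : EMomentum) : ℝ≥0∞ := ENNReal.ofReal ((‖x‖ ^ 2) ^ (-s))

theorem measurable_prop (s : ℝ) : Measurable (prop s) := by
  unfold prop; fun_prop

/-- Schwinger's trick: Euler's integral writes a propagator as a superposition of Gaussians. -/
theorem ofReal_Gamma_mul_rpow {s x : ℝ} (hs : 0 < s) (hx : 0 < x) :
    ∫⁻ t in Set.Ioi (0 : ℝ), ENNReal.ofReal (t ^ (s - 1) * Real.exp (-(x * t))) =
      ENNReal.ofReal (Real.Gamma s * x ^ (-s)) := by
  have h := Real.integral_rpow_mul_exp_neg_mul_Ioi hs hx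
  have hpos : 0 < Real.Gamma s := Real.Gamma_pos_of_pos hs
  rw [← ofReal_integral_eq_lintegral_ofReal]
  · rw [h, one_div, Real.inv_rpow hx.le, Real.rpow_neg hx.le, mul_comm]
  -- The Bochner integral of a non-integrable function is 0 by convention, so the positive value
  -- already known forces integrability.
  · by_contra hni
    rw [integral_undef hni] at h
    have : 0 < (1 / x) ^ s * Real.Gamma s := by positivity
    exact absurd h this.ne
  · filter_upwards [ae_restrict_mem measurableSet_Ioi] with t ht
    have : 0 < t := ht
    positivity

/-- Complete the square about (u / (t + u)) q; dimension four gives the factor (π / (t + u))². -/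
theorem lintegral_gaussian_mul_gaussian (q : EMomentum) {t u : ℝ} (ht : 0 < t) (hu : 0 < u) :
    ∫⁻ k : EMomentum, ENNReal.ofReal (Real.exp (-(‖k‖ ^ 2 * t)) * Real.exp (-(‖k - q‖ ^ 2 * u))) =
      ENNReal.ofReal (Real.pi ^ 2 / (t + u) ^ 2 * Real.exp (-(t * u / (t + u) * ‖q‖ ^ 2))) := by
  have htu : 0 < t + u := by positivity
  have hsq : ∀ k : EMomentum, Real.exp (-(‖k‖ ^ 2 * t)) * Real.exp (-(‖k - q‖ ^ 2 * u)) =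
      Real.exp (-(t * u / (t + u) * ‖q‖ ^ 2)) *
        Real.exp (-(t + u) * ‖k - (u / (t + u)) • q‖ ^ 2) := by
    intro k
    rw [← Real.exp_add, ← Real.exp_add, norm_sub_sq_real, norm_sub_sq_real, norm_smul, mul_pow,
      inner_smul_right, Real.norm_eq_abs, sq_abs]
    congr 1
    field_simp
    ring
  have hint : ∫ k : EMomentum, Real.exp (-(t + u) * ‖k - (u / (t + u)) • q‖ ^ 2) =
      Real.pi ^ 2 / (t + u) ^ 2 := by
    rw [integral_sub_right_eq_self (fun k : EMomentum => Real.exp (-(t + u) * ‖k‖ ^ 2)),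
      GaussianFourier.integral_rexp_neg_mul_sq_norm htu]
    rw [finrank_euclideanSpace_fin, ← div_pow, ← Real.rpow_natCast]
    norm_num
  simp_rw [hsq]
  rw [← ofReal_integral_eq_lintegral_ofReal, integral_const_mul, hint, mul_comm]
  · refine Integrable.const_mul ?_ _
    by_contra hni
    rw [integral_undef hni] at hint
    have : 0 < Real.pi ^ 2 / (t + u) ^ 2 := by positivity
    exact absurd hint this.ne
  · exact Eventually.of_forall fun k => by positivity

/-- With x = v / (1 + v) this is the integral of x^(-s) over (0, 1). -/
theorem lintegral_Ioi_rpow_mul_one_add_rpow {s : ℝ} (h1 : s < 1) :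
    ∫⁻ v in Set.Ioi (0 : ℝ), ENNReal.ofReal ((v / (1 + v)) ^ (-s) / (1 + v) ^ 2) =
      ENNReal.ofReal (1 / (1 - s)) := by
  have hs : 0 < 1 - s := by linarith
  have hcont : ContinuousWithinAt (fun v : ℝ => (v / (1 + v)) ^ (1 - s) / (1 - s))
      (Set.Ici 0) 0 := by
    refine ContinuousAt.continuousWithinAt ?_
    refine ContinuousAt.div_const (ContinuousAt.rpow_const ?_ (Or.inr hs.le)) _
    exact ContinuousAt.div (by fun_prop) (by fun_prop) (by norm_num)
  have hderiv : ∀ v ∈ Set.Ioi (0 : ℝ), HasDerivAt (fun v : ℝ => (v / (1 + v)) ^ (1 - s) / (1 - s))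
      ((v / (1 + v)) ^ (-s) / (1 + v) ^ 2) v := by
    intro v hv
    have hv : 0 < v := hv
    have h0 : HasDerivAt (fun v : ℝ => v / (1 + v)) (1 / (1 + v) ^ 2) v := by
      have := (hasDerivAt_id v).div ((hasDerivAt_id v).const_add 1) (by simp; positivity)
      exact this.congr_deriv (by simp)
    have h2 := (h0.rpow_const (p := 1 - s) (Or.inl (by positivity))).div_const (1 - s)
    refine h2.congr_deriv ?_
    rw [show 1 - s - 1 = -s by ring]
    field_simp
  have hpos : ∀ v ∈ Set.Ioi (0 : ℝ), 0 ≤ (v / (1 + v)) ^ (-s) / (1 + v) ^ 2 := by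
    intro v hv
    have hv : 0 < v := hv
    positivity
  have hlim : Tendsto (fun v : ℝ => (v / (1 + v)) ^ (1 - s) / (1 - s)) atTop
      (𝓝 (1 / (1 - s))) := by
    have h0 : Tendsto (fun v : ℝ => v / (1 + v)) atTop (𝓝 1) := by
      have h3 : Tendsto (fun v : ℝ => 1 - (1 + v)⁻¹) atTop (𝓝 (1 - 0)) :=
        (tendsto_inv_atTop_zero.comp (tendsto_atTop_add_const_left _ 1 tendsto_id)).const_sub 1
      rw [sub_zero] at h3
      refine h3.congr' ?_
      filter_upwards [eventually_gt_atTop 0] with v hv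
      field_simp
      ring
    have := (h0.rpow_const (p := 1 - s) (Or.inl one_ne_zero)).div_const (1 - s)
    rwa [Real.one_rpow] at this
  rw [← ofReal_integral_eq_lintegral_ofReal (integrableOn_Ioi_deriv_of_nonneg hcont hderiv hpos hlim),
    integral_Ioi_of_hasDerivAt_of_nonneg hcont hderiv hpos hlim]
  · simp [Real.zero_rpow hs.ne']
  · filter_upwards [ae_restrict_mem measurableSet_Ioi] with v hv using hpos v hv

theorem ae_ne_point (q : EMomentum) : ∀ᵐ k : EMomentum, k ≠ q := by
  simp [ae_iff, measure_singleton]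

/-- The one-loop chain integral in four Euclidean dimensions. -/
theorem lintegral_prop_mul_prop {s : ℝ} (h0 : 0 < s) (h1 : s < 1) {q : EMomentum} (hq : q ≠ 0) :
    ∫⁻ k, prop (1 + s) k * prop 1 (k - q) =
      ENNReal.ofReal (Real.pi ^ 2 / (s * (1 - s))) * prop s q := by
  have hG : 0 < Real.Gamma (1 + s) := Real.Gamma_pos_of_pos (by linarith)
  have hG0 : 0 < Real.Gamma s := Real.Gamma_pos_of_pos h0
  have hQ : 0 < ‖q‖ ^ 2 := by positivity
  have hs1 : 0 < 1 - s := by linarith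
  -- The Gamma factor of the Schwinger representation stays on the left, which avoids a division in
  -- `ℝ≥0∞`. By Tonelli the Gaussian k-integral may be done first.
  have key : ENNReal.ofReal (Real.Gamma (1 + s)) * ∫⁻ k, prop (1 + s) k * prop 1 (k - q) =
      ENNReal.ofReal (Real.pi ^ 2 * Real.Gamma s * (‖q‖ ^ 2) ^ (-s) * (1 / (1 - s))) := by
    calc ENNReal.ofReal (Real.Gamma (1 + s)) * ∫⁻ k, prop (1 + s) k * prop 1 (k - q)
        = ∫⁻ k, (∫⁻ t in Set.Ioi (0 : ℝ), ENNReal.ofReal (t ^ s * Real.exp (-(‖k‖ ^ 2 * t)))) *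
            ∫⁻ u in Set.Ioi (0 : ℝ), ENNReal.ofReal (Real.exp (-(‖k - q‖ ^ 2 * u))) := by
          rw [← lintegral_const_mul _ (by unfold prop; fun_prop)]
          refine lintegral_congr_ae ?_
          filter_upwards [ae_ne_point 0, ae_ne_point q] with k hk hkq
          have hk2 : 0 < ‖k‖ ^ 2 := by positivity
          have hkq2 : 0 < ‖k - q‖ ^ 2 := by
            have := norm_pos_iff.2 (sub_ne_zero.2 hkq)
            positivity
          have e1 := ofReal_Gamma_mul_rpow (s := 1 + s) (by linarith) hk2
          have e2 := ofReal_Gamma_mul_rpow one_pos hkq2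
          simp only [add_sub_cancel_left, sub_self, Real.rpow_zero, one_mul,
            Real.Gamma_one] at e1 e2
          rw [e1, e2, ENNReal.ofReal_mul hG.le, prop, prop, mul_assoc]
      _ = ∫⁻ k : EMomentum, ∫⁻ t in Set.Ioi (0 : ℝ), ∫⁻ u in Set.Ioi (0 : ℝ),
            ENNReal.ofReal (t ^ s * Real.exp (-(‖k‖ ^ 2 * t))) *
              ENNReal.ofReal (Real.exp (-(‖k - q‖ ^ 2 * u))) := by
          refine lintegral_congr fun k => ?_
          rw [← lintegral_mul_const _ (by fun_prop)]
          refine lintegral_congr fun t => ?_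
          rw [← lintegral_const_mul _ (by fun_prop)]
      _ = ∫⁻ t in Set.Ioi (0 : ℝ), ∫⁻ u in Set.Ioi (0 : ℝ), ∫⁻ k : EMomentum,
            ENNReal.ofReal (t ^ s * Real.exp (-(‖k‖ ^ 2 * t))) *
              ENNReal.ofReal (Real.exp (-(‖k - q‖ ^ 2 * u))) := by
          rw [lintegral_lintegral_swap (Measurable.aemeasurable ?_)]
          · refine lintegral_congr fun t => ?_
            rw [lintegral_lintegral_swap (Measurable.aemeasurable (by fun_prop))]
          · exact Measurable.lintegral_prod_right'
              (f := fun p : (EMomentum × ℝ) × ℝ => ENNReal.ofReal (p.1.2 ^ s *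
                Real.exp (-(‖p.1.1‖ ^ 2 * p.1.2))) *
                ENNReal.ofReal (Real.exp (-(‖p.1.1 - q‖ ^ 2 * p.2)))) (by fun_prop)
      _ = ∫⁻ t in Set.Ioi (0 : ℝ), ∫⁻ u in Set.Ioi (0 : ℝ), ENNReal.ofReal (t ^ s *
            (Real.pi ^ 2 / (t + u) ^ 2 * Real.exp (-(t * u / (t + u) * ‖q‖ ^ 2)))) := by
          refine setLIntegral_congr_fun measurableSet_Ioi fun t ht => ?_
          refine setLIntegral_congr_fun measurableSet_Ioi fun u hu => ?_
          have ht : 0 < t := ht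
          have hts : 0 ≤ t ^ s := by positivity
          have hu : 0 < u := hu
          rw [ENNReal.ofReal_mul hts, ← lintegral_gaussian_mul_gaussian q ht hu,
            ← lintegral_const_mul _ (by fun_prop)]
          refine lintegral_congr fun k => ?_
          rw [← ENNReal.ofReal_mul (by positivity), ← ENNReal.ofReal_mul hts, mul_assoc]
      _ = ∫⁻ t in Set.Ioi (0 : ℝ), ∫⁻ v in Set.Ioi (0 : ℝ), ENNReal.ofReal
            (Real.pi ^ 2 / (1 + v) ^ 2 * (t ^ (s - 1) * Real.exp (-(v / (1 + v) * ‖q‖ ^ 2 * t)))) := by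
          refine setLIntegral_congr_fun measurableSet_Ioi fun t ht => ?_
          have ht : 0 < t := ht
          -- The substitution u = t v makes the exponent linear in t, so that the t-integral is
          -- again Euler's.
          rw [lintegral_Ioi_comp_mul _ ht, ← lintegral_const_mul _ (by fun_prop)]
          refine setLIntegral_congr_fun measurableSet_Ioi fun v hv => ?_
          have hv : 0 < v := hv
          rw [← ENNReal.ofReal_mul ht.le]
          congr 1
          rw [show t * (t * v) / (t + t * v) * ‖q‖ ^ 2 = v / (1 + v) * ‖q‖ ^ 2 * t by
            field_simp, Real.rpow_sub_one ht.ne']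
          field_simp
      _ = ∫⁻ v in Set.Ioi (0 : ℝ), ∫⁻ t in Set.Ioi (0 : ℝ), ENNReal.ofReal
            (Real.pi ^ 2 / (1 + v) ^ 2 * (t ^ (s - 1) * Real.exp (-(v / (1 + v) * ‖q‖ ^ 2 * t)))) := by
          rw [lintegral_lintegral_swap (Measurable.aemeasurable (by fun_prop))]
      _ = ∫⁻ v in Set.Ioi (0 : ℝ), ENNReal.ofReal
            (Real.pi ^ 2 * Real.Gamma s * (‖q‖ ^ 2) ^ (-s)) *
              ENNReal.ofReal ((v / (1 + v)) ^ (-s) / (1 + v) ^ 2) := by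
          refine setLIntegral_congr_fun measurableSet_Ioi fun v hv => ?_
          have hv : 0 < v := hv
          simp_rw [fun t : ℝ => ENNReal.ofReal_mul (p := Real.pi ^ 2 / (1 + v) ^ 2)
            (q := t ^ (s - 1) * Real.exp (-(v / (1 + v) * ‖q‖ ^ 2 * t))) (by positivity)]
          rw [lintegral_const_mul _ (by fun_prop), ofReal_Gamma_mul_rpow h0 (by positivity),
            ← ENNReal.ofReal_mul (by positivity), ← ENNReal.ofReal_mul (by positivity),
            Real.mul_rpow (by positivity) hQ.le]
          congr 1
          field_simp
      _ = _ := by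
          rw [lintegral_const_mul _ (by fun_prop), lintegral_Ioi_rpow_mul_one_add_rpow h1,
            ← ENNReal.ofReal_mul (by positivity)]
  have hGe : ENNReal.ofReal (Real.Gamma (1 + s)) ≠ 0 := by simpa using hG
  refine (ENNReal.mul_right_inj hGe ENNReal.ofReal_ne_top).1 ?_
  rw [key, prop, ← ENNReal.ofReal_mul (by positivity), ← ENNReal.ofReal_mul hG.le, add_comm 1 s,
    Real.Gamma_add_one h0.ne']
  congr 1
  field_simp

theorem prop_neg (s : ℝ) (x : EMomentum) : prop s (-x) = prop s x := by simp [prop]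

theorem prop_sub_comm (s : ℝ) (x y : EMomentum) : prop s (x - y) = prop s (y - x) := by
  rw [← prop_neg, neg_sub]

theorem prop_map (s : ℝ) (R : EMomentum ≃ₗᵢ[ℝ] EMomentum) (x : EMomentum) :
    prop s (R x) = prop s x := by simp [prop]

theorem prop_smul (s : ℝ) {c : ℝ} (x : EMomentum) :
    prop s (c • x) = ENNReal.ofReal ((c ^ 2) ^ (-s)) * prop s x := by
  rw [prop, prop, ← ENNReal.ofReal_mul (by positivity), norm_smul, mul_pow, Real.norm_eq_abs,
    sq_abs, Real.mul_rpow (by positivity) (by positivity)]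

/-- At the origin both sides are 0, since `0 ^ (-s) = 0` for `s ≠ 0`; elsewhere exponents add. -/
theorem prop_mul_prop {s t : ℝ} (hs : 0 < s) (ht : 0 < t) (x : EMomentum) :
    prop s x * prop t x = prop (s + t) x := by
  have : 0 < s + t := by positivity
  rw [prop, prop, prop, ← ENNReal.ofReal_mul (by positivity)]
  congr 1
  rcases eq_or_ne x 0 with rfl | hx
  · simp [Real.zero_rpow, hs.ne', this.ne', -neg_add_rev]
  · rw [← Real.rpow_add (by positivity)]
    ring_nf

theorem ofReal_normSq_mul_prop_one {x : EMomentum} (hx : x ≠ 0) :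
    ENNReal.ofReal (‖x‖ ^ 2) * prop 1 x = 1 := by
  rw [prop, ← ENNReal.ofReal_mul (by positivity), Real.rpow_neg_one,
    mul_inv_cancel₀ (by positivity), ENNReal.ofReal_one]

theorem ofReal_normSq_mul_prop_one_le (x : EMomentum) :
    ENNReal.ofReal (‖x‖ ^ 2) * prop 1 x ≤ 1 := by
  rcases eq_or_ne x 0 with rfl | hx
  · simp
  · exact (ofReal_normSq_mul_prop_one hx).le

theorem prop_ne_top (s : ℝ) (x : EMomentum) : prop s x ≠ ∞ := ENNReal.ofReal_ne_top

/-- The constant of the chain integral. -/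
def chainConst (s : ℝ) : ℝ≥0∞ := ENNReal.ofReal (Real.pi ^ 2 / (s * (1 - s)))

theorem lintegral_chain {s : ℝ} (h0 : 0 < s) (h1 : s < 1) {p q : EMomentum} (hpq : p ≠ q) :
    ∫⁻ k, prop (1 + s) (k - p) * prop 1 (k - q) = chainConst s * prop s (p - q) := by
  rw [← lintegral_add_right_eq_self _ p, prop_sub_comm s p q,
    chainConst, ← lintegral_prop_mul_prop h0 h1 (sub_ne_zero.2 hpq.symm)]
  refine lintegral_congr fun k => ?_
  rw [add_sub_cancel_right, sub_sub_eq_add_sub]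

/-! ### The two-loop kite and its convergence -/

/-- The product of the five propagators of the two-loop kite at `x = (k, l)`. -/
def kiteWeight (α : ℝ) (q : EMomentum) (x : EMomentum × EMomentum) : ℝ≥0∞ :=
  prop α (x.2 - x.1) * (prop 1 x.2 * prop 1 (x.1 - q) * prop 1 x.1 * prop 1 (x.2 - q))

/-- The two-loop kite integral. -/
def kite (α : ℝ) (q : EMomentum) : ℝ≥0∞ := ∫⁻ x, kiteWeight α q x

theorem measurable_kiteWeight_uncurry (α : ℝ) :
    Measurable fun y : EMomentum × (EMomentum × EMomentum) => kiteWeight α y.1 y.2 := by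
  have := measurable_prop
  unfold kiteWeight
  fun_prop

theorem measurable_kiteWeight (α : ℝ) (q : EMomentum) : Measurable (kiteWeight α q) := by
  have := measurable_prop
  unfold kiteWeight
  fun_prop

theorem measurePreserving_reflect (q : EMomentum) :
    MeasurePreserving (fun x : EMomentum × EMomentum => (q - x.1, q - x.2)) :=
  (Measure.measurePreserving_sub_left volume q).prod (Measure.measurePreserving_sub_left volume q)

theorem measurePreserving_reflect_swap (q : EMomentum) :
    MeasurePreserving (fun x : EMomentum × EMomentum => (q - x.2, q - x.1)) :=
  (measurePreserving_reflect q).comp Measure.measurePreserving_swap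

/-- Without the propagator of l - q, the l-integral is a chain from 0 to k. Its value |k|^(-2s)
merges with 1/|k|², and the k-integral is the same chain again. The three lemmas below omit another
of the four outer propagators and follow from the reflections of the kite. -/
theorem lintegral_kite_sub {s : ℝ} (h0 : 0 < s) (h1 : s < 1) {q : EMomentum} (hq : q ≠ 0) :
    ∫⁻ x : EMomentum × EMomentum, prop (1 + s) (x.2 - x.1) *
      (prop 1 x.2 * prop 1 (x.1 - q) * prop 1 x.1) = chainConst s ^ 2 * prop s q := by
  have hm := measurable_prop
  rw [Measure.volume_eq_prod, lintegral_prod _ (Measurable.aemeasurable (by fun_prop))]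
  have h : ∀ᵐ k : EMomentum, ∫⁻ l : EMomentum, prop (1 + s) (l - k) *
      (prop 1 l * prop 1 (k - q) * prop 1 k) =
        chainConst s * (prop (1 + s) k * prop 1 (k - q)) := by
    filter_upwards [ae_ne_point 0] with k hk
    have e := lintegral_chain h0 h1 hk
    simp only [sub_zero] at e
    rw [← prop_mul_prop one_pos h0 k]
    calc _ = ∫⁻ l : EMomentum, prop (1 + s) (l - k) * prop 1 l * (prop 1 (k - q) * prop 1 k) :=
          lintegral_congr fun l => by ring
      _ = _ := by
          rw [lintegral_mul_const _ (by fun_prop), e]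
          ring
  rw [lintegral_congr_ae h, lintegral_const_mul _ (by fun_prop),
    lintegral_prop_mul_prop h0 h1 hq, ← chainConst]
  ring

theorem lintegral_kite_k {s : ℝ} (h0 : 0 < s) (h1 : s < 1) {q : EMomentum} (hq : q ≠ 0) :
    ∫⁻ x : EMomentum × EMomentum, prop (1 + s) (x.2 - x.1) *
      (prop 1 x.2 * prop 1 (x.1 - q) * prop 1 (x.2 - q)) = chainConst s ^ 2 * prop s q := by
  have hm := measurable_prop
  rw [← lintegral_kite_sub h0 h1 hq, ← (measurePreserving_reflect_swap q).lintegral_comp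
    (by fun_prop)]
  refine lintegral_congr fun x => ?_
  simp only [sub_sub_sub_cancel_left, sub_sub_cancel_left, prop_neg]
  rw [prop_sub_comm 1 q]
  ring

theorem lintegral_kite_l {s : ℝ} (h0 : 0 < s) (h1 : s < 1) {q : EMomentum} (hq : q ≠ 0) :
    ∫⁻ x : EMomentum × EMomentum, prop (1 + s) (x.2 - x.1) *
      (prop 1 (x.1 - q) * prop 1 x.1 * prop 1 (x.2 - q)) = chainConst s ^ 2 * prop s q := by
  have hm := measurable_prop
  rw [← lintegral_kite_sub h0 h1 hq, ← (measurePreserving_reflect q).lintegral_comp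
    (by fun_prop)]
  refine lintegral_congr fun x => ?_
  simp only [sub_sub_sub_cancel_left, sub_sub_cancel_left, prop_neg]
  rw [prop_sub_comm 1 q, prop_sub_comm (1 + s) x.1]
  ring

theorem lintegral_kite_k_sub {s : ℝ} (h0 : 0 < s) (h1 : s < 1) {q : EMomentum} (hq : q ≠ 0) :
    ∫⁻ x : EMomentum × EMomentum, prop (1 + s) (x.2 - x.1) *
      (prop 1 x.2 * prop 1 x.1 * prop 1 (x.2 - q)) = chainConst s ^ 2 * prop s q := by
  have hm := measurable_prop
  rw [← lintegral_kite_k h0 h1 hq, ← (measurePreserving_reflect q).lintegral_comp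
    (by fun_prop)]
  refine lintegral_congr fun x => ?_
  simp only [sub_sub_sub_cancel_left, sub_sub_cancel_left, prop_neg]
  rw [prop_sub_comm 1 q x.2, prop_sub_comm 1 q x.1, prop_sub_comm (1 + s) x.1]
  ring

theorem ae_ne_fst (p : EMomentum) : ∀ᵐ x : EMomentum × EMomentum, x.1 ≠ p :=
  Measure.quasiMeasurePreserving_fst.ae (ae_ne_point p)

theorem ae_ne_snd (p : EMomentum) : ∀ᵐ x : EMomentum × EMomentum, x.2 ≠ p :=
  Measure.quasiMeasurePreserving_snd.ae (ae_ne_point p)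

theorem ofReal_norm_add_sq_le (x y : EMomentum) :
    ENNReal.ofReal (‖x + y‖ ^ 2) ≤ 2 * ENNReal.ofReal (‖x‖ ^ 2) + 2 * ENNReal.ofReal (‖y‖ ^ 2) := by
  have h1 := norm_add_le x y
  have h2 : ‖x + y‖ ^ 2 ≤ (‖x‖ + ‖y‖) ^ 2 := by gcongr
  calc ENNReal.ofReal (‖x + y‖ ^ 2) ≤ ENNReal.ofReal (2 * ‖x‖ ^ 2 + 2 * ‖y‖ ^ 2) :=
        ENNReal.ofReal_le_ofReal (by nlinarith [sq_nonneg (‖x‖ - ‖y‖)])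
    _ = _ := by
        rw [ENNReal.ofReal_add (by positivity) (by positivity), ENNReal.ofReal_mul (by norm_num),
          ENNReal.ofReal_mul (by norm_num), ENNReal.ofReal_ofNat]

/-- The kite weights with one propagator cancelled have finite integral. -/
theorem lintegral_normSq_mul_kiteWeight_lt_top {s : ℝ} (h0 : 0 < s) (h1 : s < 1) {q : EMomentum}
    (hq : q ≠ 0) :
    ∫⁻ x : EMomentum × EMomentum, (ENNReal.ofReal (‖x.2‖ ^ 2) + ENNReal.ofReal (‖x.1 - q‖ ^ 2) +
      ENNReal.ofReal (‖x.1‖ ^ 2) + ENNReal.ofReal (‖x.2 - q‖ ^ 2)) * kiteWeight (1 + s) q x < ∞ := by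
  have hm := measurable_prop
  have hfin : chainConst s ^ 2 * prop s q ≠ ∞ :=
    ENNReal.mul_ne_top (ENNReal.pow_ne_top ENNReal.ofReal_ne_top) (prop_ne_top s q)
  -- Each squared momentum cancels its own propagator; at zero momentum the product is 0 rather than
  -- 1, hence only an inequality.
  have hle : ∀ x : EMomentum × EMomentum,
      (ENNReal.ofReal (‖x.2‖ ^ 2) + ENNReal.ofReal (‖x.1 - q‖ ^ 2) +
      ENNReal.ofReal (‖x.1‖ ^ 2) + ENNReal.ofReal (‖x.2 - q‖ ^ 2)) * kiteWeight (1 + s) q x ≤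
      prop (1 + s) (x.2 - x.1) * (prop 1 (x.1 - q) * prop 1 x.1 * prop 1 (x.2 - q)) +
      prop (1 + s) (x.2 - x.1) * (prop 1 x.2 * prop 1 x.1 * prop 1 (x.2 - q)) +
      prop (1 + s) (x.2 - x.1) * (prop 1 x.2 * prop 1 (x.1 - q) * prop 1 (x.2 - q)) +
      prop (1 + s) (x.2 - x.1) * (prop 1 x.2 * prop 1 (x.1 - q) * prop 1 x.1) := by
    intro x
    unfold kiteWeight
    have e1 := ofReal_normSq_mul_prop_one_le x.2
    have e2 := ofReal_normSq_mul_prop_one_le (x.1 - q)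
    have e3 := ofReal_normSq_mul_prop_one_le x.1
    have e4 := ofReal_normSq_mul_prop_one_le (x.2 - q)
    rw [add_mul, add_mul, add_mul]
    have hc : ∀ (a b r : ℝ≥0∞), a * b ≤ 1 → a * b * r ≤ r := fun a b r h =>
      (mul_le_mul_left h r).trans_eq (one_mul r)
    refine add_le_add (add_le_add (add_le_add ?_ ?_) ?_) ?_
    · refine le_trans (le_of_eq ?_) (hc _ _ _ e1); ring
    · refine le_trans (le_of_eq ?_) (hc _ _ _ e2); ring
    · refine le_trans (le_of_eq ?_) (hc _ _ _ e3); ring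
    · refine le_trans (le_of_eq ?_) (hc _ _ _ e4); ring
  refine (lintegral_mono hle).trans_lt ?_
  rw [lintegral_add_left (by fun_prop), lintegral_add_left (by fun_prop),
    lintegral_add_left (by fun_prop), lintegral_kite_sub h0 h1 hq, lintegral_kite_k h0 h1 hq,
    lintegral_kite_l h0 h1 hq, lintegral_kite_k_sub h0 h1 hq]
  simp only [ENNReal.add_lt_top, hfin.lt_top, and_self]

/-- Since |q|² ≤ 2|l|² + 2|l - q|², the full kite is bounded by kites with one propagator cancelled.
-/
theorem kite_one_add_ne_top {s : ℝ} (h0 : 0 < s) (h1 : s < 1) {q : EMomentum} (hq : q ≠ 0) :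
    kite (1 + s) q ≠ ∞ := by
  have h := lintegral_normSq_mul_kiteWeight_lt_top h0 h1 hq
  have hq2 : ENNReal.ofReal (‖q‖ ^ 2) ≠ 0 := by
    have : 0 < ‖q‖ ^ 2 := by positivity
    exact (ENNReal.ofReal_pos.2 this).ne'
  have hle : ENNReal.ofReal (‖q‖ ^ 2) * kite (1 + s) q ≤ 2 *
      ∫⁻ x : EMomentum × EMomentum, (ENNReal.ofReal (‖x.2‖ ^ 2) + ENNReal.ofReal (‖x.1 - q‖ ^ 2) +
      ENNReal.ofReal (‖x.1‖ ^ 2) + ENNReal.ofReal (‖x.2 - q‖ ^ 2)) * kiteWeight (1 + s) q x := by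
    rw [kite, ← lintegral_const_mul _ (measurable_kiteWeight _ _),
      ← lintegral_const_mul' _ _ (by norm_num)]
    refine lintegral_mono fun x => ?_
    rw [← mul_assoc]
    refine mul_le_mul_left ?_ _
    have h3 := ofReal_norm_add_sq_le x.2 (q - x.2)
    rw [add_sub_cancel, norm_sub_rev q x.2] at h3
    refine h3.trans ?_
    rw [mul_add, mul_add, mul_add, add_assoc, add_assoc]
    refine add_le_add le_rfl ?_
    exact le_add_left le_add_self
  intro htop
  rw [htop, ENNReal.mul_top hq2] at hle
  exact absurd (top_le_iff.1 hle) (ENNReal.mul_ne_top (by norm_num) h.ne)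

theorem normSq_sub_mul_prop {s : ℝ} (h0 : 0 < s) (x : EMomentum) :
    ENNReal.ofReal (‖x‖ ^ 2) * prop (1 + s) x = prop s x := by
  rcases eq_or_ne x 0 with rfl | hx
  · simp [prop, Real.zero_rpow, h0.ne']
  · rw [← prop_mul_prop one_pos h0, ← mul_assoc, ofReal_normSq_mul_prop_one hx, one_mul]

theorem lintegral_normSq_sub_mul_kiteWeight {s : ℝ} (h0 : 0 < s) (q : EMomentum) :
    ∫⁻ x : EMomentum × EMomentum, ENNReal.ofReal (‖x.2 - x.1‖ ^ 2) * kiteWeight (1 + s) q x =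
      kite s q := by
  refine lintegral_congr fun x => ?_
  rw [kiteWeight, kiteWeight, ← mul_assoc, normSq_sub_mul_prop h0]

theorem lintegral_normSq_fst_mul_kiteWeight {s : ℝ} (h0 : 0 < s) (h1 : s < 1) {q : EMomentum}
    (hq : q ≠ 0) :
    ∫⁻ x : EMomentum × EMomentum, ENNReal.ofReal (‖x.1‖ ^ 2) * kiteWeight (1 + s) q x =
      chainConst s ^ 2 * prop s q := by
  rw [← lintegral_kite_k h0 h1 hq]
  refine lintegral_congr_ae ?_
  filter_upwards [ae_ne_fst 0] with x hx
  have := ofReal_normSq_mul_prop_one hx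
  calc _ = ENNReal.ofReal (‖x.1‖ ^ 2) * prop 1 x.1 * (prop (1 + s) (x.2 - x.1) *
      (prop 1 x.2 * prop 1 (x.1 - q) * prop 1 (x.2 - q))) := by unfold kiteWeight; ring
    _ = _ := by rw [this, one_mul]

theorem lintegral_normSq_snd_sub_mul_kiteWeight {s : ℝ} (h0 : 0 < s) (h1 : s < 1) {q : EMomentum}
    (hq : q ≠ 0) :
    ∫⁻ x : EMomentum × EMomentum, ENNReal.ofReal (‖x.2 - q‖ ^ 2) * kiteWeight (1 + s) q x =
      chainConst s ^ 2 * prop s q := by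
  rw [← lintegral_kite_sub h0 h1 hq]
  refine lintegral_congr_ae ?_
  filter_upwards [ae_ne_snd q] with x hx
  have := ofReal_normSq_mul_prop_one (sub_ne_zero.2 hx)
  calc _ = ENNReal.ofReal (‖x.2 - q‖ ^ 2) * prop 1 (x.2 - q) * (prop (1 + s) (x.2 - x.1) *
      (prop 1 x.2 * prop 1 (x.1 - q) * prop 1 x.1)) := by unfold kiteWeight; ring
    _ = _ := by rw [this, one_mul]

instance isAddHaarMeasure_volume_prod {V W : Type*} [NormedAddCommGroup V] [NormedSpace ℝ V]
    [MeasureSpace V] [BorelSpace V] [FiniteDimensional ℝ V]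
    [(volume : Measure V).IsAddHaarMeasure] [NormedAddCommGroup W] [NormedSpace ℝ W]
    [MeasureSpace W] [BorelSpace W] [FiniteDimensional ℝ W]
    [(volume : Measure W).IsAddHaarMeasure] : (volume : Measure (V × W)).IsAddHaarMeasure :=
  inferInstanceAs ((volume : Measure V).prod (volume : Measure W)).IsAddHaarMeasure

/-! ### Scale-invariant integrals cut off to a window -/

/-- The indicator of the scales between `1/2` and `2`. -/
def scaleWindow (y : ℝ) : ℝ≥0∞ := (Set.Icc (1 / 2 : ℝ) 2).indicator 1 y

theorem measurable_scaleWindow : Measurable scaleWindow :=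
  measurable_one.indicator measurableSet_Icc

theorem scaleWindow_inv {y : ℝ} (hy : 0 < y) : scaleWindow y⁻¹ = scaleWindow y := by
  unfold scaleWindow Set.indicator
  have : y⁻¹ ∈ Set.Icc (1 / 2 : ℝ) 2 ↔ y ∈ Set.Icc (1 / 2 : ℝ) 2 := by
    rw [Set.mem_Icc, Set.mem_Icc, one_div, inv_le_inv₀ (by norm_num) hy, inv_le_comm₀ hy (by norm_num)]
    exact and_comm
  simp only [this, Pi.one_apply]

/-- The logarithmic length of the window. -/
def scaleLength : ℝ≥0∞ := ∫⁻ c in Set.Ioi (0 : ℝ), ENNReal.ofReal c⁻¹ * scaleWindow c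

/-- Invariance of dc/c under multiplication. -/
theorem lintegral_scaleWindow_mul {y : ℝ} (hy : 0 < y) :
    ∫⁻ c in Set.Ioi (0 : ℝ), ENNReal.ofReal c⁻¹ * scaleWindow (c * y) = scaleLength := by
  have hm := measurable_scaleWindow
  conv_rhs => rw [scaleLength, lintegral_Ioi_comp_mul _ hy, ← lintegral_const_mul _ (by fun_prop)]
  refine setLIntegral_congr_fun measurableSet_Ioi fun c hc => ?_
  have hc : 0 < c := hc
  rw [← mul_assoc, ← ENNReal.ofReal_mul hy.le, mul_inv, mul_inv_cancel_left₀ hy.ne', mul_comm y c]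

theorem scaleLength_ne_zero : scaleLength ≠ 0 := by
  intro h
  rw [scaleLength, lintegral_eq_zero_iff (by have := measurable_scaleWindow; fun_prop)] at h
  have h2 : ∀ᵐ c : ℝ, c ∉ Set.Ioo (1 / 2 : ℝ) 2 := by
    filter_upwards [(ae_restrict_iff' measurableSet_Ioi).1 h] with c hc hmem
    have hpos : 0 < c := by linarith [hmem.1]
    have := hc hpos
    have hI : c ∈ Set.Icc (1 / 2 : ℝ) 2 := Set.Ioo_subset_Icc_self hmem
    simp only [scaleWindow, Set.indicator_of_mem hI, Pi.one_apply, mul_one, Pi.zero_apply,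
      ENNReal.ofReal_eq_zero, inv_nonpos] at this
    linarith
  have h3 : volume (Set.Ioo (1 / 2 : ℝ) 2) = 0 :=
    measure_mono_null (fun c hc => not_not.2 hc) (ae_iff.1 h2)
  rw [Real.volume_Ioo, ENNReal.ofReal_eq_zero] at h3
  norm_num at h3

theorem scaleLength_ne_top : scaleLength ≠ ∞ := by
  have hle : scaleLength ≤ ∫⁻ c in Set.Icc (1 / 2 : ℝ) 2, ENNReal.ofReal 2 := by
    rw [scaleLength, ← lintegral_indicator measurableSet_Icc]
    refine (setLIntegral_le_lintegral _ _).trans (lintegral_mono fun c => ?_)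
    unfold scaleWindow Set.indicator
    split_ifs with h
    · simp only [Pi.one_apply, mul_one]
      refine ENNReal.ofReal_le_ofReal ?_
      rw [inv_le_comm₀ (by linarith [h.1]) (by norm_num)]
      linarith [h.1]
    · simp
  refine ne_top_of_le_ne_top ?_ hle
  rw [setLIntegral_const, Real.volume_Icc]
  exact ENNReal.mul_ne_top ENNReal.ofReal_ne_top ENNReal.ofReal_ne_top

/-- The integral of a density of homogeneity degree minus the dimension, cut off to a window of
scales, does not depend on the choice of the function measuring the scale. -/
theorem lintegral_scaleWindow_eq {V : Type*} [NormedAddCommGroup V] [NormedSpace ℝ V]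
    [MeasurableSpace V] [BorelSpace V] [FiniteDimensional ℝ V] (μ : Measure V)
    [μ.IsAddHaarMeasure] {w : V → ℝ≥0∞} (hw : Measurable w) {h₁ h₂ : V → ℝ}
    (hh₁ : Measurable h₁) (hh₂ : Measurable h₂)
    (hws : ∀ (c : ℝ) (x : V), 0 < c →
      ENNReal.ofReal (c ^ Module.finrank ℝ V) * w (c • x) = w x)
    (hs₁ : ∀ (c : ℝ) (x : V), 0 < c → h₁ (c • x) = c * h₁ x)
    (hs₂ : ∀ (c : ℝ) (x : V), 0 < c → h₂ (c • x) = c * h₂ x)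
    (hp₁ : ∀ᵐ x ∂μ, 0 < h₁ x) (hp₂ : ∀ᵐ x ∂μ, 0 < h₂ x) :
    ∫⁻ x, w x * scaleWindow (h₁ x) ∂μ = ∫⁻ x, w x * scaleWindow (h₂ x) ∂μ := by
  have hm := measurable_scaleWindow
  -- Insert the dc/c-average of the window at c · h₂, which is the constant `scaleLength`, exchange
  -- the integrals, and dilate x by c⁻¹. Homogeneity removes c from h₂ and moves c⁻¹ to h₁, whose
  -- window can then be averaged away.
  have key : scaleLength * ∫⁻ x, w x * scaleWindow (h₁ x) ∂μ =
      scaleLength * ∫⁻ x, w x * scaleWindow (h₂ x) ∂μ := by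
    calc scaleLength * ∫⁻ x, w x * scaleWindow (h₁ x) ∂μ
        = ∫⁻ x, (∫⁻ c in Set.Ioi (0 : ℝ), w x * scaleWindow (h₁ x) *
            (ENNReal.ofReal c⁻¹ * scaleWindow (c * h₂ x))) ∂μ := by
          rw [← lintegral_const_mul _ (by fun_prop)]
          refine lintegral_congr_ae ?_
          filter_upwards [hp₂] with x hx
          rw [lintegral_const_mul _ (by fun_prop), lintegral_scaleWindow_mul hx, mul_comm]
      _ = ∫⁻ c in Set.Ioi (0 : ℝ), ∫⁻ x, w x * scaleWindow (h₁ x) *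
            (ENNReal.ofReal c⁻¹ * scaleWindow (c * h₂ x)) ∂μ := by
          rw [lintegral_lintegral_swap (Measurable.aemeasurable (by fun_prop))]
      _ = ∫⁻ c in Set.Ioi (0 : ℝ), ∫⁻ x, w x * scaleWindow (h₂ x) *
            (ENNReal.ofReal c⁻¹ * scaleWindow (c⁻¹ * h₁ x)) ∂μ := by
          refine setLIntegral_congr_fun measurableSet_Ioi fun c hc => ?_
          have hc : 0 < c := hc
          have hc' : 0 < c⁻¹ := inv_pos.2 hc
          rw [lintegral_comp_smul_addHaar μ _ hc', ← lintegral_const_mul _ (by fun_prop)]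
          refine lintegral_congr fun x => ?_
          rw [hs₁ _ _ hc', hs₂ _ _ hc', mul_inv_cancel_left₀ hc.ne', ← hws _ x hc']
          ring
      _ = ∫⁻ x, (∫⁻ c in Set.Ioi (0 : ℝ), w x * scaleWindow (h₂ x) *
            (ENNReal.ofReal c⁻¹ * scaleWindow (c⁻¹ * h₁ x))) ∂μ := by
          rw [lintegral_lintegral_swap (Measurable.aemeasurable (by fun_prop))]
      _ = scaleLength * ∫⁻ x, w x * scaleWindow (h₂ x) ∂μ := by
          rw [← lintegral_const_mul _ (by fun_prop)]
          refine lintegral_congr_ae ?_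
          filter_upwards [hp₁] with x hx
          rw [lintegral_const_mul _ (by fun_prop), mul_comm,
            ← lintegral_scaleWindow_mul (inv_pos.2 hx)]
          congr 1
          refine setLIntegral_congr_fun measurableSet_Ioi fun c hc => ?_
          have hc : 0 < c := hc
          -- The window [1/2, 2] is stable under inversion, which turns c⁻¹ h₁ into c h₁⁻¹.
          rw [← scaleWindow_inv (y := c * (h₁ x)⁻¹) (by positivity), mul_inv, inv_inv]
  exact (ENNReal.mul_right_inj scaleLength_ne_zero scaleLength_ne_top).1 key

theorem LinearMap.measurePreserving_of_involutive {V : Type*} [NormedAddCommGroup V]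
    [NormedSpace ℝ V] [MeasurableSpace V] [BorelSpace V] [FiniteDimensional ℝ V] (μ : Measure V)
    [μ.IsAddHaarMeasure] (f : V →ₗ[ℝ] V) (hf : ∀ x, f (f x) = x) : MeasurePreserving f μ μ := by
  have hdet : LinearMap.det f * LinearMap.det f = 1 := by
    rw [← LinearMap.det_comp, show f ∘ₗ f = LinearMap.id from LinearMap.ext hf, LinearMap.det_id]
  have h0 : LinearMap.det f ≠ 0 := left_ne_zero_of_mul_eq_one hdet
  refine ⟨f.continuous_of_finiteDimensional.measurable, ?_⟩
  rw [Measure.map_linearMap_addHaar_eq_smul_addHaar μ h0]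
  have habs : |LinearMap.det f| = 1 := by
    rcases mul_self_eq_one_iff.1 hdet with h | h <;> simp [h]
  rw [abs_inv, habs, inv_one, ENNReal.ofReal_one, one_smul]

/-! ### Closing the kite: the duality of exponents α and 2 - α -/

theorem measurePreserving_prodMap_isometry (R : EMomentum ≃ₗᵢ[ℝ] EMomentum) :
    MeasurePreserving (fun x : EMomentum × EMomentum => (R x.1, R x.2)) :=
  R.measurePreserving.prod R.measurePreserving

theorem kite_map (α : ℝ) (R : EMomentum ≃ₗᵢ[ℝ] EMomentum) (q : EMomentum) :
    kite α (R q) = kite α q := by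
  rw [kite, ← (measurePreserving_prodMap_isometry R).lintegral_comp (measurable_kiteWeight _ _)]
  refine lintegral_congr fun x => ?_
  simp only [kiteWeight, ← map_sub, prop_map]

theorem kiteWeight_smul (α : ℝ) {c : ℝ} (q : EMomentum) (x : EMomentum × EMomentum) :
    kiteWeight α (c • q) (c • x) = ENNReal.ofReal ((c ^ 2) ^ (-α) * ((c ^ 2) ^ (-1 : ℝ)) ^ 4) *
      kiteWeight α q x := by
  rw [ENNReal.ofReal_mul (by positivity), ENNReal.ofReal_pow (by positivity)]
  simp only [kiteWeight, Prod.smul_fst, Prod.smul_snd, ← smul_sub, prop_smul]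
  ring

theorem finrank_prod_EMomentum : Module.finrank ℝ (EMomentum × EMomentum) = 8 := by
  rw [Module.finrank_prod, finrank_euclideanSpace_fin]

theorem kite_smul (α : ℝ) {c : ℝ} (hc : 0 < c) (q : EMomentum) :
    kite α (c • q) = ENNReal.ofReal ((c ^ 2) ^ (-α)) * kite α q := by
  have hm := measurable_kiteWeight α q
  rw [kite, lintegral_comp_smul_addHaar volume _ hc, finrank_prod_EMomentum]
  simp_rw [kiteWeight_smul]
  rw [lintegral_const_mul _ hm, ← mul_assoc, ← ENNReal.ofReal_mul (by positivity), kite]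
  congr 2
  rw [Real.rpow_neg_one]
  field_simp

/-- The Euclidean unit vector in the time direction. -/
def timeVec : EMomentum := EuclideanSpace.single 0 1

theorem norm_timeVec : ‖timeVec‖ = 1 := by simp [timeVec]

theorem timeVec_ne_zero : timeVec ≠ 0 := norm_ne_zero_iff.1 (by simp [norm_timeVec])

/-- The reflection in the hyperplane orthogonal to v - w. -/
theorem exists_isometry_eq {v w : EMomentum} (h : ‖v‖ = ‖w‖) :
    ∃ R : EMomentum ≃ₗᵢ[ℝ] EMomentum, R v = w :=
  ⟨_, Submodule.reflection_sub h⟩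

/-- Rotation invariance and homogeneity leave one number, the value at a unit vector. -/
theorem kite_eq (α : ℝ) {q : EMomentum} (hq : q ≠ 0) :
    kite α q = prop α q * kite α timeVec := by
  have hn : 0 < ‖q‖ := norm_pos_iff.2 hq
  obtain ⟨R, hR⟩ := exists_isometry_eq (v := ‖q‖ • timeVec) (w := q)
    (by simp [norm_smul, norm_timeVec])
  conv_lhs => rw [← hR, kite_map, kite_smul α hn]
  rfl

/-- The kite with its external line closed, on triples `(q, (k, l))`. -/
def gluedWeight (α : ℝ) (y : EMomentum × (EMomentum × EMomentum)) : ℝ≥0∞ :=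
  prop (2 - α) y.1 * kiteWeight α y.1 y.2

theorem measurable_gluedWeight (α : ℝ) : Measurable (gluedWeight α) := by
  have := measurable_prop
  have := measurable_kiteWeight_uncurry α
  unfold gluedWeight
  fun_prop

theorem finrank_triple_EMomentum :
    Module.finrank ℝ (EMomentum × (EMomentum × EMomentum)) = 12 := by
  rw [Module.finrank_prod, finrank_prod_EMomentum, finrank_euclideanSpace_fin]

/-- The six exponents add up to (2 - α) + α + 4 = 6, so the degree is -12, minus the dimension of
the space of triples. -/
theorem gluedWeight_smul (α : ℝ) {c : ℝ} (hc : 0 < c)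
    (y : EMomentum × (EMomentum × EMomentum)) :
    ENNReal.ofReal (c ^ 12) * gluedWeight α (c • y) = gluedWeight α y := by
  simp only [gluedWeight, Prod.smul_fst, Prod.smul_snd, kiteWeight_smul, prop_smul]
  have h : c ^ 12 * ((c ^ 2) ^ (-(2 - α)) * ((c ^ 2) ^ (-α) * ((c ^ 2) ^ (-1 : ℝ)) ^ 4)) = 1 := by
    have : (c ^ 2) ^ (-(2 - α)) * (c ^ 2) ^ (-α) = ((c ^ 2) ^ 2)⁻¹ := by
      rw [← Real.rpow_add (by positivity), show -(2 - α) + -α = -(2 : ℕ) by push_cast; ring,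
        Real.rpow_neg (by positivity), Real.rpow_natCast]
    rw [← mul_assoc ((c ^ 2) ^ (-(2 - α))), this, Real.rpow_neg_one]
    field_simp
  calc _ = ENNReal.ofReal (c ^ 12) * (ENNReal.ofReal ((c ^ 2) ^ (-(2 - α))) *
        ENNReal.ofReal ((c ^ 2) ^ (-α) * ((c ^ 2) ^ (-1 : ℝ)) ^ 4)) *
        (prop (2 - α) y.1 * kiteWeight α y.1 y.2) := by ring
    _ = _ := by
      rw [← ENNReal.ofReal_mul (by positivity), ← ENNReal.ofReal_mul (by positivity), h,
        ENNReal.ofReal_one, one_mul]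

/-- Relabelling of the four vertices `0, q, k, l` of the closed kite: `0 ↔ l`, `q ↔ k`. -/
def relabel : EMomentum × (EMomentum × EMomentum) →ₗ[ℝ] EMomentum × (EMomentum × EMomentum) where
  toFun y := (y.2.1 - y.2.2, (y.1 - y.2.2, -y.2.2))
  map_add' y z := by ext <;> simp <;> ring
  map_smul' c y := by ext <;> simp <;> ring

/-- The edges {0, q} and {k, l}, of exponents 2 - α and α, trade places; the four edges of exponent
1 are permuted among themselves. Translation by -l puts the new vertex 0 back at the origin. -/
theorem gluedWeight_relabel (α : ℝ) (y : EMomentum × (EMomentum × EMomentum)) :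
    gluedWeight α (relabel y) = gluedWeight (2 - α) y := by
  simp only [gluedWeight, kiteWeight, relabel, LinearMap.coe_mk, AddHom.coe_mk, sub_sub_cancel]
  rw [show -y.2.2 - (y.1 - y.2.2) = -y.1 by abel,
    show y.1 - y.2.2 - (y.2.1 - y.2.2) = y.1 - y.2.1 by abel,
    show -y.2.2 - (y.2.1 - y.2.2) = -y.2.1 by abel, prop_neg, prop_neg, prop_neg,
    prop_sub_comm _ y.2.1 y.2.2, prop_sub_comm _ y.1 y.2.1, prop_sub_comm _ y.1 y.2.2]
  ring

/-- The window integral of the radial density `(‖q‖²)^(-2)`. -/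
def radialWindow : ℝ≥0∞ := ∫⁻ q : EMomentum, prop 2 q * scaleWindow ‖q‖

/-- Integrating over (k, l) first yields a kite of homogeneity -α in |q|²; with the closing line
this makes |q|^(-4) for every α. -/
theorem lintegral_gluedWeight {α : ℝ} (h0 : 0 < α) (h2 : α < 2) :
    ∫⁻ y, gluedWeight α y * scaleWindow ‖y.1‖ = radialWindow * kite α timeVec := by
  have hm := measurable_scaleWindow
  have hp := measurable_prop
  have hg := measurable_gluedWeight α
  have hk := measurable_kiteWeight α
  rw [Measure.volume_eq_prod, lintegral_prod _ (Measurable.aemeasurable (by fun_prop)),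
    radialWindow, ← lintegral_mul_const _ (by fun_prop)]
  refine lintegral_congr_ae ?_
  filter_upwards [ae_ne_point 0] with q hq
  simp only [gluedWeight]
  calc _ = ∫⁻ x, prop (2 - α) q * scaleWindow ‖q‖ * kiteWeight α q x :=
        lintegral_congr fun x => by ring
    _ = _ := by
      rw [lintegral_const_mul _ (hk q), ← kite, kite_eq α hq,
        show (2 : ℝ) = (2 - α) + α by ring, ← prop_mul_prop (by linarith) h0, sub_add_cancel]
      ring

theorem radialWindow_ne_zero : radialWindow ≠ 0 := by
  intro h
  have hm := measurable_scaleWindow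
  have hp := measurable_prop
  rw [radialWindow, lintegral_eq_zero_iff (by fun_prop)] at h
  set A : Set EMomentum := Metric.ball 0 2 \ Metric.closedBall 0 (1 / 2) with hA
  have hopen : IsOpen A := Metric.isOpen_ball.sdiff Metric.isClosed_closedBall
  have hne : A.Nonempty := ⟨timeVec, by simp [hA, norm_timeVec]; norm_num⟩
  refine (hopen.measure_pos volume hne).ne' ?_
  refine measure_mono_null ?_ (ae_iff.1 h)
  rintro q ⟨hq1, hq2⟩
  rw [mem_ball_zero_iff] at hq1
  rw [mem_closedBall_zero_iff, not_le] at hq2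
  have hI : ‖q‖ ∈ Set.Icc (1 / 2 : ℝ) 2 := ⟨hq2.le, hq1.le⟩
  have hpos : 0 < ‖q‖ := by linarith
  change ¬ (prop 2 q * scaleWindow ‖q‖ = 0)
  rw [scaleWindow, Set.indicator_of_mem hI, Pi.one_apply, mul_one, prop, ENNReal.ofReal_eq_zero,
    not_le]
  positivity

theorem radialWindow_ne_top : radialWindow ≠ ∞ := by
  -- The bound 16 is |q|^(-4) at the lower end |q| = 1/2 of the window.
  have hle : radialWindow ≤ ∫⁻ q in Metric.closedBall (0 : EMomentum) 2, ENNReal.ofReal 16 := by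
    rw [radialWindow, ← lintegral_indicator Metric.isClosed_closedBall.measurableSet]
    refine lintegral_mono fun q => ?_
    unfold scaleWindow Set.indicator
    by_cases h : ‖q‖ ∈ Set.Icc (1 / 2 : ℝ) 2
    · have hpos : 0 < ‖q‖ := by linarith [h.1]
      rw [if_pos h, if_pos (mem_closedBall_zero_iff.2 h.2), Pi.one_apply, mul_one, prop]
      refine ENNReal.ofReal_le_ofReal ?_
      rw [Real.rpow_neg (by positivity), show (2 : ℝ) = (2 : ℕ) by norm_num, Real.rpow_natCast,
        inv_le_comm₀ (by positivity) (by norm_num), ← pow_mul]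
      calc (16 : ℝ)⁻¹ = (1 / 2) ^ (2 * 2) := by norm_num
        _ ≤ _ := by gcongr; exact h.1
    · rw [if_neg h, mul_zero]
      exact zero_le
  refine ne_top_of_le_ne_top ?_ hle
  rw [setLIntegral_const]
  exact ENNReal.mul_ne_top ENNReal.ofReal_ne_top measure_closedBall_lt_top.ne

/-- The closed graph is evaluated twice, with scale measured by |q| and by |k - l|. The relabelling
turns the second into the first with 2 - α for α, and the common radial factor is finite and
nonzero. -/
theorem kite_two_sub_timeVec {α : ℝ} (h0 : 0 < α) (h2 : α < 2) :
    kite (2 - α) timeVec = kite α timeVec := by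
  have hg := measurable_gluedWeight α
  have hm := measurable_scaleWindow
  have hrel : MeasurePreserving relabel := by
    refine LinearMap.measurePreserving_of_involutive volume relabel fun y => ?_
    simp [relabel]
  have hne1 : ∀ᵐ y : EMomentum × (EMomentum × EMomentum), 0 < ‖y.1‖ := by
    filter_upwards [Measure.quasiMeasurePreserving_fst.ae (ae_ne_point 0)] with y hy
    exact norm_pos_iff.2 hy
  have hne2 : ∀ᵐ y : EMomentum × (EMomentum × EMomentum), 0 < ‖y.2.1 - y.2.2‖ :=
    hrel.quasiMeasurePreserving.ae hne1
  have h := lintegral_scaleWindow_eq volume hg (h₁ := fun y => ‖y.1‖)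
    (h₂ := fun y => ‖y.2.1 - y.2.2‖) (by fun_prop) (by fun_prop)
    (fun c y hc => by rw [finrank_triple_EMomentum, gluedWeight_smul α hc])
    (fun c y hc => by simp [norm_smul, abs_of_pos hc])
    (fun c y hc => by simp [norm_smul, abs_of_pos hc, ← smul_sub]) hne1 hne2
  have e : ∫⁻ y : EMomentum × (EMomentum × EMomentum),
      gluedWeight α y * scaleWindow ‖y.2.1 - y.2.2‖ =
      ∫⁻ y : EMomentum × (EMomentum × EMomentum), gluedWeight (2 - α) y * scaleWindow ‖y.1‖ := by
    rw [← hrel.lintegral_comp (by fun_prop)]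
    refine lintegral_congr fun y => ?_
    rw [gluedWeight_relabel]
    congr 3
    simp [relabel]
  rw [e, lintegral_gluedWeight h0 h2, lintegral_gluedWeight (by linarith) (by linarith)] at h
  exact ((ENNReal.mul_right_inj radialWindow_ne_zero radialWindow_ne_top).1 h).symm

/-- Duality transports finiteness from the exponent 1 + (1 - s). -/
theorem kite_ne_top {s : ℝ} (h0 : 0 < s) (h1 : s < 1) : kite s timeVec ≠ ∞ := by
  rw [← kite_two_sub_timeVec h0 (by linarith), show 2 - s = 1 + (1 - s) by ring]
  exact kite_one_add_ne_top (by linarith) (by linarith) timeVec_ne_zero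

/-! ### Majorants on the strip -/

theorem norm_ofReal_cpow_neg {x : ℝ} (hx : 0 ≤ x) {ρ : ℂ} (hρ : ρ.re ≠ 0) :
    ‖(x : ℂ) ^ (-ρ)‖ = x ^ (-ρ.re) := by
  rcases hx.eq_or_lt with rfl | hx
  · have : -ρ ≠ 0 := fun h => hρ (by simpa using congrArg Complex.re h)
    simp [Complex.zero_cpow this, Real.zero_rpow (neg_ne_zero.2 hρ)]
  · rw [Complex.norm_cpow_eq_rpow_re_of_pos hx, Complex.neg_re]

/-- The larger exponent dominates for x ≤ 1, the smaller for x ≥ 1. This yields majorants uniform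
for ρ near a point of the strip. -/
theorem rpow_neg_le_add {x s s₁ s₂ : ℝ} (hx : 0 ≤ x) (h₁ : 0 < s₁) (h₁s : s₁ ≤ s) (hs₂ : s ≤ s₂) :
    x ^ (-s) ≤ x ^ (-s₁) + x ^ (-s₂) := by
  rcases hx.eq_or_lt with rfl | hx
  · rw [Real.zero_rpow (by linarith), Real.zero_rpow (by linarith), Real.zero_rpow (by linarith),
      add_zero]
  · rcases le_total x 1 with h | h
    · have := Real.rpow_le_rpow_of_exponent_ge hx h (neg_le_neg hs₂)
      have := Real.rpow_nonneg hx.le (-s₁)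
      linarith
    · have := Real.rpow_le_rpow_of_exponent_le h (neg_le_neg h₁s)
      have := Real.rpow_nonneg hx.le (-s₂)
      linarith

theorem integrable_and_integral_of_lintegral {X : Type*} [MeasurableSpace X] {μ : Measure X}
    {f : X → ℝ} (hf : Measurable f) (h0 : ∀ x, 0 ≤ f x) {v : ℝ≥0∞}
    (h : ∫⁻ x, ENNReal.ofReal (f x) ∂μ = v) (hv : v ≠ ∞) :
    Integrable f μ ∧ ∫ x, f x ∂μ = v.toReal := by
  refine ⟨(lintegral_ofReal_ne_top_iff_integrable hf.aestronglyMeasurable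
    (Eventually.of_forall h0)).1 (h ▸ hv), ?_⟩
  rw [integral_eq_lintegral_of_nonneg_ae (Eventually.of_forall h0) hf.aestronglyMeasurable, h]

/-- For every point of the strip there are exponents `0 < s₁ < s₂ < 1` which enclose the real
parts of all nearby points. -/
theorem exists_re_bounds {ρ : ℂ} (hρ : ρ ∈ mellinStrip) :
    ∃ s₁ s₂ : ℝ, 0 < s₁ ∧ s₁ < 1 ∧ 0 < s₂ ∧ s₂ < 1 ∧
      ∀ᶠ z : ℂ in 𝓝 ρ, s₁ ≤ z.re ∧ z.re ≤ s₂ := by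
  obtain ⟨h0, h1⟩ := hρ
  refine ⟨ρ.re / 2, (ρ.re + 1) / 2, by linarith, by linarith, by linarith, by linarith, ?_⟩
  have hc : Tendsto Complex.re (𝓝 ρ) (𝓝 ρ.re) := Complex.continuous_re.tendsto ρ
  filter_upwards [hc (Ioo_mem_nhds (by linarith : ρ.re / 2 < ρ.re)
    (by linarith : ρ.re < (ρ.re + 1) / 2))] with z hz
  exact ⟨hz.1.le, hz.2.le⟩

theorem differentiable_cpow_neg_of_ne {c : ℂ} {U : Set ℂ} (hU : ∀ z ∈ U, z ≠ 0) :
    DifferentiableOn ℂ (fun ρ : ℂ => c ^ (-ρ)) U := by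
  intro z hz
  refine DifferentiableAt.differentiableWithinAt ?_
  refine DifferentiableAt.const_cpow (by fun_prop) (Or.inr (neg_ne_zero.2 (hU z hz)))

theorem ne_zero_of_mem_mellinStrip {ρ : ℂ} (hρ : ρ ∈ mellinStrip) : ρ ≠ 0 := by
  rintro rfl
  exact lt_irrefl _ hρ.1

/-! ### One loop -/

/-- The Euclidean one-loop integrand at a real exponent. -/
def loopReal (s : ℝ) (q k : EMomentum) : ℝ := (‖k‖ ^ 2) ^ (-s) / (‖k‖ ^ 2 * ‖k - q‖ ^ 2)

/-- The Euclidean one-loop integrand. -/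
def euclLoop (ρ : ℂ) (q k : EMomentum) : ℂ :=
  1 / ((‖k‖ ^ 2 * ‖k - q‖ ^ 2 : ℝ) : ℂ) * ((‖k‖ ^ 2 : ℝ) : ℂ) ^ (-ρ)

theorem measurable_loopReal (s : ℝ) (q : EMomentum) : Measurable (loopReal s q) := by
  unfold loopReal; fun_prop

theorem measurable_euclLoop (ρ : ℂ) (q : EMomentum) : Measurable (euclLoop ρ q) := by
  unfold euclLoop; fun_prop

theorem loopReal_nonneg (s : ℝ) (q k : EMomentum) : 0 ≤ loopReal s q k := by
  unfold loopReal; positivity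

theorem euclLoop_ofReal (s : ℝ) (q k : EMomentum) : euclLoop s q k = (loopReal s q k : ℂ) := by
  rw [euclLoop, loopReal, ← Complex.ofReal_neg, ← Complex.ofReal_cpow (by positivity)]
  push_cast
  ring

theorem norm_euclLoop {ρ : ℂ} (hρ : ρ.re ≠ 0) (q k : EMomentum) :
    ‖euclLoop ρ q k‖ = loopReal ρ.re q k := by
  rw [euclLoop, norm_mul, norm_ofReal_cpow_neg (by positivity) hρ, loopReal, norm_div, norm_one,
    Complex.norm_real, Real.norm_of_nonneg (by positivity)]
  ring

theorem rpow_neg_one_add {s x : ℝ} (hs : 0 < s) (hx : 0 ≤ x) :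
    x ^ (-(1 + s)) = x ^ (-s) / x := by
  rcases hx.eq_or_lt with rfl | hx
  · rw [Real.zero_rpow (by linarith), div_zero]
  · rw [neg_add_rev, ← sub_eq_add_neg, Real.rpow_sub_one hx.ne']

theorem integrable_and_integral_loopReal {s : ℝ} (h0 : 0 < s) (h1 : s < 1) {q : EMomentum}
    (hq : q ≠ 0) : Integrable (loopReal s q) ∧
      ∫ k, loopReal s q k = Real.pi ^ 2 / (s * (1 - s)) * (‖q‖ ^ 2) ^ (-s) := by
  have hs1 : 0 < 1 - s := by linarith
  have h := integrable_and_integral_of_lintegral (μ := volume) (measurable_loopReal s q) (loopReal_nonneg s q)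
    (v := ENNReal.ofReal (Real.pi ^ 2 / (s * (1 - s))) * prop s q) ?_
    (ENNReal.mul_ne_top ENNReal.ofReal_ne_top (prop_ne_top s q))
  · refine ⟨h.1, h.2.trans ?_⟩
    rw [prop, ENNReal.toReal_mul, ENNReal.toReal_ofReal (by positivity),
      ENNReal.toReal_ofReal (by positivity)]
  · rw [← lintegral_prop_mul_prop h0 h1 hq]
    refine lintegral_congr fun k => ?_
    rw [prop, prop, ← ENNReal.ofReal_mul (by positivity), loopReal,
      rpow_neg_one_add h0 (by positivity), Real.rpow_neg_one]
    congr 1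
    field_simp

/-- Both sides are holomorphic on the strip and agree at real ρ by the chain integral. -/
theorem integral_euclLoop {ρ : ℂ} (hρ : ρ ∈ mellinStrip) {q : EMomentum} (hq : q ≠ 0) :
    ∫ k, euclLoop ρ q k =
      (Real.pi : ℂ) ^ 2 / (ρ * (1 - ρ)) * ((‖q‖ ^ 2 : ℝ) : ℂ) ^ (-ρ) := by
  refine eqOn_of_eqOn_real isOpen_mellinStrip isPreconnected_mellinStrip
    (f := fun ρ => ∫ k, euclLoop ρ q k)
    (g := fun ρ => (Real.pi : ℂ) ^ 2 / (ρ * (1 - ρ)) * ((‖q‖ ^ 2 : ℝ) : ℂ) ^ (-ρ))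
    ?_ ?_ half_mem_mellinStrip ?_ hρ
  · refine differentiableOn_integral_of_dominated isOpen_mellinStrip
      (fun z _ => (measurable_euclLoop z q).aestronglyMeasurable) (fun k => ?_) fun ρ₀ hρ₀ => ?_
    · unfold euclLoop
      exact (differentiable_cpow_neg_of_ne fun z hz => ne_zero_of_mem_mellinStrip hz).const_mul _
    · obtain ⟨s₁, s₂, h1, h1', h2, h2', hb⟩ := exists_re_bounds hρ₀
      refine ⟨fun k => loopReal s₁ q k + loopReal s₂ q k,
        (integrable_and_integral_loopReal h1 h1' hq).1.add
          (integrable_and_integral_loopReal h2 h2' hq).1, ?_⟩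
      filter_upwards [hb] with z hz k
      rw [norm_euclLoop (by linarith [hz.1]), loopReal, loopReal, loopReal, ← add_div]
      gcongr
      exact rpow_neg_le_add (by positivity) h1 hz.1 hz.2
  · refine DifferentiableOn.mul (DifferentiableOn.div (by fun_prop) (by fun_prop) fun z hz => ?_)
      (differentiable_cpow_neg_of_ne fun z hz => ne_zero_of_mem_mellinStrip hz)
    exact mul_ne_zero (ne_zero_of_mem_mellinStrip hz)
      (ne_zero_of_mem_mellinStrip (one_sub_mem_mellinStrip hz))
  · filter_upwards [Ioo_mem_nhds (by norm_num : (0 : ℝ) < 1 / 2) (by norm_num : (1 / 2 : ℝ) < 1)]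
      with s hs
    simp_rw [euclLoop_ofReal]
    rw [integral_complex_ofReal, (integrable_and_integral_loopReal hs.1 hs.2 hq).2,
      ← Complex.ofReal_neg, ← Complex.ofReal_cpow (by positivity)]
    push_cast
    ring

/-! ### Two loops -/

/-- The Euclidean two-loop weight at a real exponent. -/
def kiteReal (s : ℝ) (q : EMomentum) (x : EMomentum × EMomentum) : ℝ :=
  (‖x.2 - x.1‖ ^ 2) ^ (-s) /
    (‖x.2 - x.1‖ ^ 2 * ‖x.2‖ ^ 2 * ‖x.1 - q‖ ^ 2 * ‖x.1‖ ^ 2 * ‖x.2 - q‖ ^ 2)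

/-- The Euclidean two-loop weight. -/
def euclKite (ρ : ℂ) (q : EMomentum) (x : EMomentum × EMomentum) : ℂ :=
  1 / ((‖x.2 - x.1‖ ^ 2 * ‖x.2‖ ^ 2 * ‖x.1 - q‖ ^ 2 * ‖x.1‖ ^ 2 * ‖x.2 - q‖ ^ 2 : ℝ) : ℂ) *
    ((‖x.2 - x.1‖ ^ 2 : ℝ) : ℂ) ^ (-ρ)

theorem measurable_kiteReal (s : ℝ) (q : EMomentum) : Measurable (kiteReal s q) := by
  unfold kiteReal; fun_prop

theorem measurable_euclKite (ρ : ℂ) (q : EMomentum) : Measurable (euclKite ρ q) := by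
  unfold euclKite; fun_prop

theorem kiteReal_nonneg (s : ℝ) (q : EMomentum) (x : EMomentum × EMomentum) :
    0 ≤ kiteReal s q x := by
  unfold kiteReal; positivity

theorem euclKite_ofReal (s : ℝ) (q : EMomentum) (x : EMomentum × EMomentum) :
    euclKite s q x = (kiteReal s q x : ℂ) := by
  rw [euclKite, kiteReal, ← Complex.ofReal_neg, ← Complex.ofReal_cpow (by positivity)]
  push_cast
  ring

theorem norm_euclKite {ρ : ℂ} (hρ : ρ.re ≠ 0) (q : EMomentum) (x : EMomentum × EMomentum) :
    ‖euclKite ρ q x‖ = kiteReal ρ.re q x := by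
  rw [euclKite, norm_mul, norm_ofReal_cpow_neg (by positivity) hρ, kiteReal, norm_div, norm_one,
    Complex.norm_real, Real.norm_of_nonneg (by positivity)]
  ring

theorem ofReal_kiteReal {s : ℝ} (h0 : 0 < s) (q : EMomentum) (x : EMomentum × EMomentum) :
    ENNReal.ofReal (kiteReal s q x) = kiteWeight (1 + s) q x := by
  simp only [kiteWeight, prop]
  rw [← ENNReal.ofReal_mul (by positivity), ← ENNReal.ofReal_mul (by positivity),
    ← ENNReal.ofReal_mul (by positivity), ← ENNReal.ofReal_mul (by positivity), kiteReal,
    rpow_neg_one_add h0 (by positivity)]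
  simp only [Real.rpow_neg_one]
  congr 1
  field_simp

/-- The sum of the squared momenta which dominates the numerators. -/
def momentumSum (q : EMomentum) (x : EMomentum × EMomentum) : ℝ :=
  ‖x.2‖ ^ 2 + ‖x.1 - q‖ ^ 2 + ‖x.1‖ ^ 2 + ‖x.2 - q‖ ^ 2

theorem integrable_momentumSum_mul_kiteReal {s : ℝ} (h0 : 0 < s) (h1 : s < 1) {q : EMomentum}
    (hq : q ≠ 0) : Integrable fun x => momentumSum q x * kiteReal s q x := by
  have hm := measurable_kiteReal s q
  refine (lintegral_ofReal_ne_top_iff_integrable (Measurable.aestronglyMeasurable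
    (by unfold momentumSum; fun_prop)) (Eventually.of_forall fun x =>
      mul_nonneg (by unfold momentumSum; positivity) (kiteReal_nonneg s q x))).1 ?_
  refine ne_of_eq_of_ne (lintegral_congr fun x => ?_)
    (lintegral_normSq_mul_kiteWeight_lt_top h0 h1 hq).ne
  rw [momentumSum, ENNReal.ofReal_mul (by positivity), ofReal_kiteReal h0,
    ENNReal.ofReal_add (by positivity) (by positivity),
    ENNReal.ofReal_add (by positivity) (by positivity),
    ENNReal.ofReal_add (by positivity) (by positivity)]

theorem norm_mul_norm_le_momentumSum (q : EMomentum) (x : EMomentum × EMomentum) :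
    ‖x.2‖ * ‖q - x.1‖ ≤ momentumSum q x := by
  rw [momentumSum, norm_sub_rev q]
  nlinarith [sq_nonneg (‖x.2‖ - ‖x.1 - q‖), sq_nonneg ‖x.2‖, sq_nonneg ‖x.1 - q‖,
    sq_nonneg ‖x.1‖, sq_nonneg ‖x.2 - q‖]

/-- The Euclidean two-loop integral with contracted numerator. -/
def euclTwoLoop (ρ : ℂ) (q : EMomentum) : ℂ :=
  ∫ x : EMomentum × EMomentum, euclKite ρ q x * ((⟪x.2, q - x.1⟫_ℝ : ℝ) : ℂ)

theorem differentiableOn_euclTwoLoop {q : EMomentum} (hq : q ≠ 0) :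
    DifferentiableOn ℂ (fun ρ => euclTwoLoop ρ q) mellinStrip := by
  refine differentiableOn_integral_of_dominated isOpen_mellinStrip
    (fun z _ => Measurable.aestronglyMeasurable
      (by have := measurable_euclKite z q; fun_prop)) (fun k => ?_) fun ρ₀ hρ₀ => ?_
  · unfold euclKite
    exact ((differentiable_cpow_neg_of_ne fun z hz =>
      ne_zero_of_mem_mellinStrip hz).const_mul _).mul_const _
  · obtain ⟨s₁, s₂, h1, h1', h2, h2', hb⟩ := exists_re_bounds hρ₀
    refine ⟨fun x => momentumSum q x * kiteReal s₁ q x + momentumSum q x * kiteReal s₂ q x,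
      (integrable_momentumSum_mul_kiteReal h1 h1' hq).add
        (integrable_momentumSum_mul_kiteReal h2 h2' hq), ?_⟩
    filter_upwards [hb] with z hz x
    rw [norm_mul, norm_euclKite (by linarith [hz.1]), mul_comm, ← mul_add, Complex.norm_real,
      Real.norm_eq_abs]
    refine mul_le_mul ((abs_real_inner_le_norm _ _).trans (norm_mul_norm_le_momentumSum q x)) ?_
      (kiteReal_nonneg _ _ _) (by unfold momentumSum; positivity)
    rw [kiteReal, kiteReal, kiteReal, ← add_div]
    gcongr
    exact rpow_neg_le_add (by positivity) h1 hz.1 hz.2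

/-- Polarisation: 2⟨l, q - k⟩ = |q|² + |l - k|² - |k|² - |l - q|². The factor |l - k|² lowers the
middle exponent by one; |k|² and |l - q|² each cancel a propagator. -/
theorem euclTwoLoop_ofReal {s : ℝ} (h0 : 0 < s) (h1 : s < 1) :
    euclTwoLoop s timeVec = (((kite (1 + s) timeVec).toReal + (kite s timeVec).toReal -
      2 * (chainConst s ^ 2).toReal) / 2 : ℝ) := by
  have hq := timeVec_ne_zero
  have hm := measurable_kiteReal s timeVec
  have hk := kiteReal_nonneg s timeVec
  have hprop : prop s timeVec = 1 := by simp [prop, norm_timeVec]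
  have hc : chainConst s ^ 2 * prop s timeVec ≠ ∞ :=
    ENNReal.mul_ne_top (ENNReal.pow_ne_top ENNReal.ofReal_ne_top) (prop_ne_top _ _)
  obtain ⟨i0, e0⟩ := integrable_and_integral_of_lintegral hm hk
    (by simp_rw [ofReal_kiteReal h0]; rfl) (kite_one_add_ne_top h0 h1 hq)
  obtain ⟨i1, e1⟩ := integrable_and_integral_of_lintegral (μ := volume)
    (f := fun x => ‖x.2 - x.1‖ ^ 2 * kiteReal s timeVec x) (by fun_prop)
    (fun x => mul_nonneg (by positivity) (hk x))
    (by simp_rw [fun x : EMomentum × EMomentum => ENNReal.ofReal_mul (p := ‖x.2 - x.1‖ ^ 2)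
          (q := kiteReal s timeVec x) (by positivity), ofReal_kiteReal h0]
        exact lintegral_normSq_sub_mul_kiteWeight h0 _) (kite_ne_top h0 h1)
  obtain ⟨i2, e2⟩ := integrable_and_integral_of_lintegral (μ := volume)
    (f := fun x => ‖x.1‖ ^ 2 * kiteReal s timeVec x) (by fun_prop)
    (fun x => mul_nonneg (by positivity) (hk x))
    (by simp_rw [fun x : EMomentum × EMomentum => ENNReal.ofReal_mul (p := ‖x.1‖ ^ 2)
          (q := kiteReal s timeVec x) (by positivity), ofReal_kiteReal h0]
        exact lintegral_normSq_fst_mul_kiteWeight h0 h1 hq) hc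
  obtain ⟨i3, e3⟩ := integrable_and_integral_of_lintegral (μ := volume)
    (f := fun x => ‖x.2 - timeVec‖ ^ 2 * kiteReal s timeVec x) (by fun_prop)
    (fun x => mul_nonneg (by positivity) (hk x))
    (by simp_rw [fun x : EMomentum × EMomentum => ENNReal.ofReal_mul (p := ‖x.2 - timeVec‖ ^ 2)
          (q := kiteReal s timeVec x) (by positivity), ofReal_kiteReal h0]
        exact lintegral_normSq_snd_sub_mul_kiteWeight h0 h1 hq) hc
  rw [hprop, mul_one] at e2 e3
  have hpt : ∀ x : EMomentum × EMomentum, kiteReal s timeVec x * ⟪x.2, timeVec - x.1⟫_ℝ =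
      (kiteReal s timeVec x + ‖x.2 - x.1‖ ^ 2 * kiteReal s timeVec x -
        (‖x.1‖ ^ 2 * kiteReal s timeVec x + ‖x.2 - timeVec‖ ^ 2 * kiteReal s timeVec x)) / 2 := by
    intro x
    rw [inner_sub_right, norm_sub_sq_real, norm_sub_sq_real, norm_timeVec]
    ring
  rw [euclTwoLoop]
  simp_rw [euclKite_ofReal, ← Complex.ofReal_mul]
  rw [integral_complex_ofReal]
  congr 1
  simp_rw [hpt]
  have hsub := integral_sub (i0.add i1) (i2.add i3)
  simp only [Pi.add_apply] at hsub
  rw [integral_div, hsub, integral_add i0 i1, integral_add i2 i3,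
    e0, e1, e2, e3]
  ring

/-- Duality pairs the exponent 1 + s with 1 - s and s with 2 - s, so the two kite terms trade
places; the chain constant depends only on s (1 - s). -/
theorem euclTwoLoop_one_sub {s : ℝ} (h0 : 0 < s) (h1 : s < 1) :
    euclTwoLoop s timeVec = euclTwoLoop ((1 - s : ℝ) : ℂ) timeVec := by
  rw [euclTwoLoop_ofReal h0 h1, euclTwoLoop_ofReal (by linarith) (by linarith),
    show 1 + (1 - s) = 2 - s by ring, kite_two_sub_timeVec h0 (by linarith),
    ← kite_two_sub_timeVec (α := 1 + s) (by linarith) (by linarith),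
    show 2 - (1 + s) = 1 - s by ring, chainConst, chainConst, sub_sub_cancel, mul_comm (1 - s) s,
    add_comm (kite (1 - s) timeVec).toReal]

/-! ### Reduction of the Euclidean tensor integral -/

/-- The Euclidean two-loop tensor integral, contracted with `u` and `v`. -/
def twoLoopTensor (ρ : ℂ) (u v q : EMomentum) : ℂ :=
  ∫ x : EMomentum × EMomentum, euclKite ρ q x * ((⟪u, x.2⟫_ℝ * ⟪v, q - x.1⟫_ℝ : ℝ) : ℂ)

theorem integrable_twoLoopTensor {ρ : ℂ} (hρ : ρ ∈ mellinStrip) (u v : EMomentum) {q : EMomentum}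
    (hq : q ≠ 0) : Integrable fun x : EMomentum × EMomentum =>
      euclKite ρ q x * ((⟪u, x.2⟫_ℝ * ⟪v, q - x.1⟫_ℝ : ℝ) : ℂ) := by
  have hm := measurable_euclKite ρ q
  refine ((integrable_momentumSum_mul_kiteReal hρ.1 hρ.2 hq).const_mul (‖u‖ * ‖v‖)).mono'
    (Measurable.aestronglyMeasurable (by fun_prop)) (Eventually.of_forall fun x => ?_)
  rw [norm_mul, norm_euclKite hρ.1.ne', Complex.norm_real, Real.norm_eq_abs, abs_mul, mul_comm,
    ← mul_assoc]
  refine mul_le_mul_of_nonneg_right ?_ (kiteReal_nonneg _ _ _)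
  calc |⟪u, x.2⟫_ℝ| * |⟪v, q - x.1⟫_ℝ| ≤ (‖u‖ * ‖x.2‖) * (‖v‖ * ‖q - x.1‖) := by
        gcongr <;> exact abs_real_inner_le_norm _ _
    _ = ‖u‖ * ‖v‖ * (‖x.2‖ * ‖q - x.1‖) := by ring
    _ ≤ _ := by gcongr; exact norm_mul_norm_le_momentumSum q x

theorem twoLoopTensor_map (ρ : ℂ) (R : EMomentum ≃ₗᵢ[ℝ] EMomentum) (u v q : EMomentum) :
    twoLoopTensor ρ (R u) (R v) (R q) = twoLoopTensor ρ u v q := by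
  have hR := measurePreserving_prodMap_isometry R
  have hRe : MeasurableEmbedding (fun x : EMomentum × EMomentum => (R x.1, R x.2)) :=
    (R.toHomeomorph.prodCongr R.toHomeomorph).measurableEmbedding
  rw [twoLoopTensor, ← hR.integral_comp hRe]
  refine integral_congr_ae (Eventually.of_forall fun x => ?_)
  simp only [euclKite, ← map_sub, LinearIsometryEquiv.norm_map, LinearIsometryEquiv.inner_map_map]

theorem twoLoopTensor_smul_left (ρ : ℂ) (c : ℝ) (u v q : EMomentum) :
    twoLoopTensor ρ (c • u) v q = c * twoLoopTensor ρ u v q := by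
  rw [twoLoopTensor, twoLoopTensor, ← integral_const_mul]
  refine integral_congr_ae (Eventually.of_forall fun x => ?_)
  simp only [inner_smul_left, RCLike.conj_to_real]
  push_cast
  ring

theorem twoLoopTensor_smul_right (ρ : ℂ) (c : ℝ) (u v q : EMomentum) :
    twoLoopTensor ρ u (c • v) q = c * twoLoopTensor ρ u v q := by
  rw [twoLoopTensor, twoLoopTensor, ← integral_const_mul]
  refine integral_congr_ae (Eventually.of_forall fun x => ?_)
  simp only [inner_smul_left, RCLike.conj_to_real]
  push_cast
  ring

theorem twoLoopTensor_add_left {ρ : ℂ} (hρ : ρ ∈ mellinStrip) (u u' v : EMomentum) {q : EMomentum}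
    (hq : q ≠ 0) :
    twoLoopTensor ρ (u + u') v q = twoLoopTensor ρ u v q + twoLoopTensor ρ u' v q := by
  rw [twoLoopTensor, twoLoopTensor, twoLoopTensor, ← integral_add
    (integrable_twoLoopTensor hρ u v hq) (integrable_twoLoopTensor hρ u' v hq)]
  refine integral_congr_ae (Eventually.of_forall fun x => ?_)
  simp only [inner_add_left]
  push_cast
  ring

theorem twoLoopTensor_add_right {ρ : ℂ} (hρ : ρ ∈ mellinStrip) (u v v' : EMomentum)
    {q : EMomentum} (hq : q ≠ 0) :
    twoLoopTensor ρ u (v + v') q = twoLoopTensor ρ u v q + twoLoopTensor ρ u v' q := by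
  rw [twoLoopTensor, twoLoopTensor, twoLoopTensor, ← integral_add
    (integrable_twoLoopTensor hρ u v hq) (integrable_twoLoopTensor hρ u v' hq)]
  refine integral_congr_ae (Eventually.of_forall fun x => ?_)
  simp only [inner_add_left]
  push_cast
  ring

theorem twoLoopTensor_smul (ρ : ℂ) {c : ℝ} (hc : 0 < c) (u v q : EMomentum) :
    twoLoopTensor ρ u v (c • q) = ((c ^ 2 : ℝ) : ℂ) ^ (-ρ) * twoLoopTensor ρ u v q := by
  have h := Measure.integral_comp_smul (volume : Measure (EMomentum × EMomentum))
    (fun x : EMomentum × EMomentum =>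
      euclKite ρ (c • q) x * ((⟪u, x.2⟫_ℝ * ⟪v, c • q - x.1⟫_ℝ : ℝ) : ℂ)) c
  rw [finrank_prod_EMomentum, abs_of_pos (by positivity), ← twoLoopTensor] at h
  have h2 : twoLoopTensor ρ u v (c • q) = ((c ^ 8 : ℝ) : ℂ) *
      ((c ^ 8)⁻¹ • twoLoopTensor ρ u v (c • q)) := by
    rw [Complex.real_smul, ← mul_assoc, ← Complex.ofReal_mul,
      mul_inv_cancel₀ (by positivity), Complex.ofReal_one, one_mul]
  rw [h2, ← h, ← integral_const_mul, twoLoopTensor, ← integral_const_mul]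
  refine integral_congr_ae (Eventually.of_forall fun x => ?_)
  have hc0 : (c : ℂ) ≠ 0 := Complex.ofReal_ne_zero.2 hc.ne'
  simp only [euclKite, Prod.smul_fst, Prod.smul_snd, ← smul_sub, norm_smul, mul_pow,
    Real.norm_eq_abs, sq_abs, inner_smul_right]
  rw [Complex.ofReal_mul (c ^ 2), Complex.mul_cpow_ofReal_nonneg (by positivity) (by positivity)]
  push_cast
  field_simp

/-- The second Euclidean unit vector. -/
def spaceVec : EMomentum := EuclideanSpace.single 1 1

theorem norm_spaceVec : ‖spaceVec‖ = 1 := by simp [spaceVec]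

theorem inner_timeVec_spaceVec : ⟪timeVec, spaceVec⟫_ℝ = 0 := by
  simp [timeVec, spaceVec, EuclideanSpace.inner_single_left]

theorem reflection_apply_of_inner_eq_zero {w q : EMomentum} (h : ⟪w, q⟫_ℝ = 0) :
    (ℝ ∙ w)ᗮ.reflection q = q :=
  Submodule.reflection_mem_subspace_eq_self (Submodule.mem_orthogonal_singleton_iff_inner_right.2 h)

/-- Two orthogonal vectors can be rotated to the directions of the first two coordinate axes. -/
theorem exists_isometry_frame {q w : EMomentum} (hq : ‖q‖ = 1) (hqw : ⟪q, w⟫_ℝ = 0) :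
    ∃ R : EMomentum ≃ₗᵢ[ℝ] EMomentum, R q = timeVec ∧ R w = ‖w‖ • spaceVec := by
  obtain ⟨R₁, h₁⟩ := exists_isometry_eq (v := q) (w := timeVec) (by rw [hq, norm_timeVec])
  have h2 : ‖R₁ w‖ = ‖‖w‖ • spaceVec‖ := by simp [norm_smul, norm_spaceVec]
  refine ⟨R₁.trans (ℝ ∙ (R₁ w - ‖w‖ • spaceVec))ᗮ.reflection, ?_, ?_⟩
  · rw [LinearIsometryEquiv.trans_apply, h₁]
    refine reflection_apply_of_inner_eq_zero ?_
    rw [inner_sub_left, inner_smul_left, real_inner_comm, ← h₁, LinearIsometryEquiv.inner_map_map,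
      hqw, h₁, real_inner_comm, inner_timeVec_spaceVec]
    simp
  · rw [LinearIsometryEquiv.trans_apply]
    exact Submodule.reflection_sub h2

/-- The longitudinal part of the tensor integral. -/
def tensorLong (ρ : ℂ) : ℂ := twoLoopTensor ρ timeVec timeVec timeVec

/-- The transversal part of the tensor integral. -/
def tensorTrans (ρ : ℂ) : ℂ := twoLoopTensor ρ spaceVec spaceVec timeVec

/-- Split u into its parts along and orthogonal to q. Rotations move these to fixed axes, and the
mixed terms vanish by a reflection. -/
theorem twoLoopTensor_unit {ρ : ℂ} (hρ : ρ ∈ mellinStrip) (u : EMomentum) {q : EMomentum}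
    (hq : ‖q‖ = 1) : twoLoopTensor ρ u u q =
      tensorTrans ρ * ((‖u‖ ^ 2 : ℝ) : ℂ) +
        (tensorLong ρ - tensorTrans ρ) * ((⟪u, q⟫_ℝ ^ 2 : ℝ) : ℂ) := by
  have hq0 : q ≠ 0 := norm_ne_zero_iff.1 (by simp [hq])
  set c : ℝ := ⟪u, q⟫_ℝ with hc
  set w : EMomentum := u - c • q with hw
  have hqw : ⟪q, w⟫_ℝ = 0 := by
    rw [hw, inner_sub_right, inner_smul_right, real_inner_self_eq_norm_sq, hq, hc, real_inner_comm]
    ring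
  have hu : u = c • q + w := by rw [hw]; abel
  obtain ⟨R, hRq, hRw⟩ := exists_isometry_frame hq hqw
  have hqq : twoLoopTensor ρ q q q = tensorLong ρ := by
    rw [← twoLoopTensor_map ρ R, hRq, tensorLong]
  have hww : twoLoopTensor ρ w w q = ((‖w‖ ^ 2 : ℝ) : ℂ) * tensorTrans ρ := by
    rw [← twoLoopTensor_map ρ R, hRq, hRw, twoLoopTensor_smul_left, twoLoopTensor_smul_right,
      tensorTrans]
    push_cast
    ring
  -- This reflection fixes q and negates w, so each mixed term equals its own negative.
  have hSq : (ℝ ∙ w)ᗮ.reflection q = q :=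
    reflection_apply_of_inner_eq_zero (by rw [real_inner_comm, hqw])
  have hSw : (ℝ ∙ w)ᗮ.reflection w = (-1 : ℝ) • w := by
    rw [Submodule.reflection_orthogonalComplement_singleton_eq_neg, neg_one_smul]
  have hqw0 : twoLoopTensor ρ q w q = 0 := by
    have h := twoLoopTensor_map ρ (ℝ ∙ w)ᗮ.reflection q w q
    rw [hSq, hSw, twoLoopTensor_smul_right] at h
    push_cast at h
    linear_combination (-1 / 2 : ℂ) * h
  have hwq0 : twoLoopTensor ρ w q q = 0 := by
    have h := twoLoopTensor_map ρ (ℝ ∙ w)ᗮ.reflection w q q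
    rw [hSq, hSw, twoLoopTensor_smul_left] at h
    push_cast at h
    linear_combination (-1 / 2 : ℂ) * h
  have hwn : ‖u‖ ^ 2 = c ^ 2 + ‖w‖ ^ 2 := by
    rw [hu, norm_add_sq_real, inner_smul_left, hqw, norm_smul, hq]
    simp
  have hexp : twoLoopTensor ρ u u q = twoLoopTensor ρ (c • q + w) (c • q + w) q := by rw [← hu]
  rw [hexp, twoLoopTensor_add_left hρ _ _ _ hq0, twoLoopTensor_add_right hρ _ _ _ hq0,
    twoLoopTensor_add_right hρ _ _ _ hq0, hww, twoLoopTensor_smul_left, twoLoopTensor_smul_left,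
    twoLoopTensor_smul_right, twoLoopTensor_smul_right, hqw0, hwq0, hqq, hwn]
  push_cast
  ring

theorem twoLoopTensor_eq {ρ : ℂ} (hρ : ρ ∈ mellinStrip) (u : EMomentum) {q : EMomentum}
    (hq : q ≠ 0) : twoLoopTensor ρ u u q = ((‖q‖ ^ 2 : ℝ) : ℂ) ^ (-ρ) *
      (tensorTrans ρ * ((‖u‖ ^ 2 : ℝ) : ℂ) +
        (tensorLong ρ - tensorTrans ρ) * ((⟪u, q⟫_ℝ ^ 2 / ‖q‖ ^ 2 : ℝ) : ℂ)) := by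
  have hn : 0 < ‖q‖ := norm_pos_iff.2 hq
  have h1 : ‖(‖q‖⁻¹ • q)‖ = 1 := by rw [norm_smul, norm_inv, norm_norm, inv_mul_cancel₀ hn.ne']
  have h2 : q = ‖q‖ • (‖q‖⁻¹ • q) := by rw [smul_smul, mul_inv_cancel₀ hn.ne', one_smul]
  conv_lhs => rw [h2, twoLoopTensor_smul ρ hn, twoLoopTensor_unit hρ u h1]
  rw [inner_smul_right, mul_pow, inv_pow, ← div_eq_inv_mul]

theorem inner_eq_sum_single (x y : EMomentum) : ⟪x, y⟫_ℝ =
    ∑ i, ⟪EuclideanSpace.single i (1 : ℝ), x⟫_ℝ * ⟪EuclideanSpace.single i (1 : ℝ), y⟫_ℝ := by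
  simp [PiLp.inner_apply, mul_comm]

/-- The trace over an orthonormal basis with one vector along q and three orthogonal to it. -/
theorem euclTwoLoop_eq {ρ : ℂ} (hρ : ρ ∈ mellinStrip) :
    euclTwoLoop ρ timeVec = tensorLong ρ + 3 * tensorTrans ρ := by
  have h : euclTwoLoop ρ timeVec = ∑ i : Fin 4, twoLoopTensor ρ (EuclideanSpace.single i 1)
      (EuclideanSpace.single i 1) timeVec := by
    simp only [twoLoopTensor]
    rw [← integral_finsetSum _ fun i _ => integrable_twoLoopTensor hρ _ _ timeVec_ne_zero]
    refine integral_congr_ae (Eventually.of_forall fun x => ?_)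
    simp only [inner_eq_sum_single x.2, Complex.ofReal_sum, Finset.mul_sum]
  rw [h, Fin.sum_univ_four]
  simp only [twoLoopTensor_unit hρ _ norm_timeVec]
  simp [timeVec, EuclideanSpace.inner_single_left]
  ring

/-! ### The complex metric and spatial dilations -/

/-- The quadratic form `k₀² + a |𝐤|²` with a complex parameter `a`. -/
def metricSq (a : ℂ) (k : Momentum) : ℂ := ((k 0 ^ 2 : ℝ) : ℂ) + a * (spatialSq k : ℂ)

theorem spatialSq_nonneg (k : Momentum) : 0 ≤ spatialSq k := by
  unfold spatialSq; positivity

/-- The map to Euclidean space which dilates the spatial part by `r`. -/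
def embed (r : ℝ) (k : Momentum) : EMomentum := WithLp.toLp 2 fun i => ![1, r, r, r] i * k i

theorem embed_add (r : ℝ) (k l : Momentum) : embed r (k + l) = embed r k + embed r l := by
  ext i; simp [embed, mul_add]

theorem embed_sub (r : ℝ) (k l : Momentum) : embed r (k - l) = embed r k - embed r l := by
  ext i; simp [embed, mul_sub]

theorem norm_embed_sq (r : ℝ) (k : Momentum) :
    ‖embed r k‖ ^ 2 = k 0 ^ 2 + r ^ 2 * spatialSq k := by
  rw [EuclideanSpace.real_norm_sq_eq, Fin.sum_univ_four]
  simp [embed, spatialSq]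
  ring

theorem metricSq_sq (r : ℝ) (k : Momentum) :
    metricSq ((r ^ 2 : ℝ) : ℂ) k = ((‖embed r k‖ ^ 2 : ℝ) : ℂ) := by
  rw [norm_embed_sq, metricSq]
  push_cast
  ring

theorem inner_single_embed (r : ℝ) (i : Fin 4) (k : Momentum) :
    ⟪EuclideanSpace.single i (1 : ℝ), embed r k⟫_ℝ = ![1, r, r, r] i * k i := by
  simp [EuclideanSpace.inner_single_left, embed]

theorem measurable_embed (r : ℝ) : Measurable (embed r) := by
  unfold embed; fun_prop

theorem map_embed_volume {r : ℝ} (hr : 0 < r) :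
    (volume : Measure Momentum).map (embed r) = ENNReal.ofReal (r ^ 3)⁻¹ • volume := by
  have hdet : (Matrix.diagonal ![1, r, r, r]).det = r ^ 3 := by
    rw [Matrix.det_diagonal, Fin.prod_univ_four]
    simp
    ring
  have h := Real.smul_map_diagonal_volume_pi (D := ![1, r, r, r])
    (by rw [hdet]; positivity)
  rw [hdet, abs_of_pos (by positivity)] at h
  have hcomp : embed r = WithLp.toLp 2 ∘ Matrix.toLin' (Matrix.diagonal ![1, r, r, r]) := by
    funext k
    ext i
    simp [embed, Matrix.mulVec_diagonal]
  have h2 : Measurable (Matrix.toLin' (Matrix.diagonal ![1, r, r, r])) :=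
    (LinearMap.continuous_of_finiteDimensional _).measurable
  have h3 : (volume : Measure Momentum).map (Matrix.toLin' (Matrix.diagonal ![1, r, r, r])) =
      ENNReal.ofReal (r ^ 3)⁻¹ • volume := by
    conv_rhs => rw [← h, smul_smul, ← ENNReal.ofReal_mul (by positivity),
      inv_mul_cancel₀ (by positivity), ENNReal.ofReal_one, one_smul]
  rw [hcomp, ← Measure.map_map (PiLp.volume_preserving_toLp (Fin 4)).measurable h2, h3,
    Measure.map_smul, (PiLp.volume_preserving_toLp (Fin 4)).map_eq]

/-- The map of pairs of momenta to Euclidean space, with the sign of the first one reversed. -/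
def embedPair (r : ℝ) (x : Momentum × Momentum) : EMomentum × EMomentum :=
  (-embed r x.1, embed r x.2)

theorem measurable_embedPair (r : ℝ) : Measurable (embedPair r) := by
  have := measurable_embed r
  unfold embedPair
  fun_prop

theorem map_embedPair_volume {r : ℝ} (hr : 0 < r) :
    (volume : Measure (Momentum × Momentum)).map (embedPair r) =
      ENNReal.ofReal ((r ^ 3)⁻¹ ^ 2) • volume := by
  have hneg : (volume : Measure Momentum).map (fun k => -embed r k) =
      ENNReal.ofReal (r ^ 3)⁻¹ • volume := by
    have : (fun k => -embed r k) = Neg.neg ∘ embed r := rfl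
    rw [this, ← Measure.map_map measurable_neg (measurable_embed r), map_embed_volume hr,
      Measure.map_smul, Measure.map_neg_eq_self]
  have h : embedPair r = Prod.map (fun k => -embed r k) (embed r) := rfl
  rw [h, Measure.volume_eq_prod, ← Measure.map_prod_map (f := fun k => -embed r k) _ _
    (measurable_embed r).neg
    (measurable_embed r), hneg, map_embed_volume hr, Measure.prod_smul_left,
    Measure.prod_smul_right, smul_smul, ← ENNReal.ofReal_mul (by positivity), ← pow_two]
  rfl

theorem integral_comp_embed {r : ℝ} (hr : 0 < r) {f : EMomentum → ℂ} (hf : Measurable f) :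
    ∫ k, f (embed r k) = (((r ^ 3)⁻¹ : ℝ) : ℂ) * ∫ k, f k := by
  rw [← integral_map (measurable_embed r).aemeasurable hf.aestronglyMeasurable,
    map_embed_volume hr, integral_smul_measure, ENNReal.toReal_ofReal (by positivity),
    Complex.real_smul]

theorem integral_comp_embedPair {r : ℝ} (hr : 0 < r) {f : EMomentum × EMomentum → ℂ}
    (hf : Measurable f) :
    ∫ x, f (embedPair r x) = (((r ^ 3)⁻¹ ^ 2 : ℝ) : ℂ) * ∫ x, f x := by
  rw [← integral_map (measurable_embedPair r).aemeasurable hf.aestronglyMeasurable,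
    map_embedPair_volume hr, integral_smul_measure, ENNReal.toReal_ofReal (by positivity),
    Complex.real_smul]

theorem integrable_comp_embed {f : EMomentum → ℝ} (hf : Integrable f) :
    Integrable fun k => f (embed 1 k) := by
  have h : MeasurePreserving (embed 1) :=
    ⟨measurable_embed 1, by simpa using map_embed_volume one_pos⟩
  exact h.integrable_comp_of_integrable hf

theorem integrable_comp_embedPair {f : EMomentum × EMomentum → ℝ} (hf : Integrable f) :
    Integrable fun x => f (embedPair 1 x) := by
  have h : MeasurePreserving (embedPair 1) :=
    ⟨measurable_embedPair 1, by simpa using map_embedPair_volume one_pos⟩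
  exact h.integrable_comp_of_integrable hf

/-! ### Bounds on the complex quadratic form -/

theorem metricSq_of_embed_eq_zero {k : Momentum} (hk : embed 1 k = 0) (a : ℂ) :
    metricSq a k = 0 := by
  have h := norm_embed_sq 1 k
  have h0 := spatialSq_nonneg k
  rw [hk] at h
  simp only [norm_zero] at h
  have h1 : spatialSq k = 0 := by nlinarith [sq_nonneg (k 0)]
  have h2 : k 0 ^ 2 = 0 := by nlinarith
  simp [metricSq, h1, h2]

/-- The form is a combination of 1 and a with nonnegative coefficients, not both zero, and these
stay off the cut. -/
theorem metricSq_mem_slitPlane {a : ℂ} (ha : a ∈ Complex.slitPlane) {k : Momentum}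
    (hk : embed 1 k ≠ 0) : metricSq a k ∈ Complex.slitPlane := by
  have h := norm_embed_sq 1 k
  have hpos : 0 < ‖embed 1 k‖ ^ 2 := by positivity
  have h0 := spatialSq_nonneg k
  rw [Complex.mem_slitPlane_iff] at ha ⊢
  have hre : (metricSq a k).re = k 0 ^ 2 + a.re * spatialSq k := by simp [metricSq, pow_two]
  have him : (metricSq a k).im = a.im * spatialSq k := by simp [metricSq, pow_two]
  rw [hre, him]
  rcases h0.eq_or_lt with h1 | h1
  · left
    rw [← h1] at h ⊢
    nlinarith
  · rcases ha with ha | ha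
    · left
      nlinarith [sq_nonneg (k 0), mul_pos ha h1]
    · right
      exact mul_ne_zero ha h1.ne'

/-- Off the cut, k₀² and a|𝐤|² cannot cancel. Every integrand for the metric a is thereby dominated
by its Euclidean counterpart, locally uniformly in a. -/
theorem exists_metricSq_bound {a₀ : ℂ} (ha₀ : a₀ ∈ Complex.slitPlane) :
    ∃ c : ℝ, 0 < c ∧ ∀ᶠ a in 𝓝 a₀, ∀ k, c * ‖embed 1 k‖ ^ 2 ≤ ‖metricSq a k‖ := by
  obtain ⟨c, hc, hb⟩ : ∃ c : ℝ, 0 < c ∧ ∀ k, c * ‖embed 1 k‖ ^ 2 ≤ ‖metricSq a₀ k‖ := by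
    by_cases him : a₀.im = 0
    · have hre : 0 < a₀.re := by
        rcases Complex.mem_slitPlane_iff.1 ha₀ with h | h
        · exact h
        · exact absurd him h
      refine ⟨min 1 a₀.re, lt_min one_pos hre, fun k => ?_⟩
      rw [norm_embed_sq]
      have h0 := spatialSq_nonneg k
      refine le_trans ?_ (Complex.re_le_norm _)
      have : (metricSq a₀ k).re = k 0 ^ 2 + a₀.re * spatialSq k := by simp [metricSq, pow_two]
      rw [this, one_pow, one_mul, mul_add]
      have e1 := mul_le_mul_of_nonneg_right (min_le_left 1 a₀.re) (sq_nonneg (k 0))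
      have e2 := mul_le_mul_of_nonneg_right (min_le_right 1 a₀.re) h0
      linarith
    · have him' : 0 < |a₀.im| := abs_pos.2 him
      -- The imaginary part bounds |𝐤|² by ‖metricSq a₀ k‖ / |Im a₀|, and k₀² is at most ‖metricSq
      -- a₀ k‖ + ‖a₀‖ |𝐤|²; the sum of the two bounds gives D.
      set D := 1 + (‖a₀‖ + 1) / |a₀.im| with hD
      have hDpos : 0 < D := by positivity
      refine ⟨D⁻¹, inv_pos.2 hDpos, fun k => ?_⟩
      rw [norm_embed_sq, inv_mul_le_iff₀ hDpos, one_pow, one_mul]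
      have h0 := spatialSq_nonneg k
      have e1 : |a₀.im| * spatialSq k ≤ ‖metricSq a₀ k‖ := by
        refine le_trans (le_of_eq ?_) (Complex.abs_im_le_norm _)
        have : (metricSq a₀ k).im = a₀.im * spatialSq k := by simp [metricSq, pow_two]
        rw [this, abs_mul, abs_of_nonneg h0]
      have e2 : k 0 ^ 2 ≤ ‖metricSq a₀ k‖ + ‖a₀‖ * spatialSq k := by
        have h1 : ((k 0 ^ 2 : ℝ) : ℂ) = metricSq a₀ k - a₀ * (spatialSq k : ℂ) := by
          simp [metricSq]
        have h2 := norm_sub_le (metricSq a₀ k) (a₀ * (spatialSq k : ℂ))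
        rw [← h1, norm_mul, Complex.norm_real, Complex.norm_real, Real.norm_of_nonneg h0,
          Real.norm_of_nonneg (sq_nonneg _)] at h2
        exact h2
      have e3 : spatialSq k ≤ ‖metricSq a₀ k‖ / |a₀.im| := by
        rw [le_div_iff₀ him', mul_comm]
        exact e1
      have e4 : (‖a₀‖ + 1) * spatialSq k ≤ (‖a₀‖ + 1) * (‖metricSq a₀ k‖ / |a₀.im|) := by gcongr
      have e5 : D * ‖metricSq a₀ k‖ =
          ‖metricSq a₀ k‖ + (‖a₀‖ + 1) * (‖metricSq a₀ k‖ / |a₀.im|) := by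
        rw [hD]; ring
      rw [e5]
      linarith
  -- Moving a by at most c / 2 costs at most half of the lower bound.
  refine ⟨c / 2, by positivity, ?_⟩
  filter_upwards [Metric.ball_mem_nhds a₀ (half_pos hc)] with a ha k
  have h0 := spatialSq_nonneg k
  have h1 : metricSq a₀ k = metricSq a k - (a - a₀) * (spatialSq k : ℂ) := by
    unfold metricSq; ring
  have h2 := norm_sub_le (metricSq a k) ((a - a₀) * (spatialSq k : ℂ))
  rw [← h1, norm_mul, Complex.norm_real, Real.norm_of_nonneg h0] at h2
  have h3 : ‖a - a₀‖ ≤ c / 2 := by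
    rw [← dist_eq_norm]
    exact (Metric.mem_ball.1 ha).le
  have h4 : spatialSq k ≤ ‖embed 1 k‖ ^ 2 := by
    rw [norm_embed_sq]
    nlinarith [sq_nonneg (k 0)]
  have h5 : ‖a - a₀‖ * spatialSq k ≤ c / 2 * ‖embed 1 k‖ ^ 2 := by gcongr
  linarith [hb k]

theorem norm_one_div_le_of_bound {c N : ℝ} (hc : 0 < c) (hN : 0 ≤ N) {z : ℂ}
    (h0 : N = 0 → z = 0) (h : c * N ≤ ‖z‖) : ‖z‖⁻¹ ≤ c⁻¹ * N⁻¹ := by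
  rcases hN.eq_or_lt with h1 | h1
  · rw [h0 h1.symm]
    simp [← h1]
  · rw [← mul_inv]
    exact inv_anti₀ (by positivity) h

/-- The exponential factor bounds the contribution of the argument, at most π in modulus. For N = 0
both powers take their default value 0. -/
theorem norm_cpow_neg_le_of_bound {c N : ℝ} (hc : 0 < c) (hN : 0 ≤ N) {z ρ : ℂ} (hρ : 0 < ρ.re)
    (h0 : N = 0 → z = 0) (h : c * N ≤ ‖z‖) :
    ‖z ^ (-ρ)‖ ≤ Real.exp (Real.pi * |ρ.im|) * c ^ (-ρ.re) * N ^ (-ρ.re) := by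
  rcases hN.eq_or_lt with h1 | h1
  · have hne : -ρ ≠ 0 := fun h => hρ.ne' (by simpa using congrArg Complex.re h)
    rw [h0 h1.symm, Complex.zero_cpow hne, norm_zero]
    positivity
  · refine (Complex.norm_cpow_le z (-ρ)).trans ?_
    rw [div_eq_mul_inv, ← Real.exp_neg, mul_comm, mul_assoc, ← Real.mul_rpow hc.le hN,
      Complex.neg_re, Complex.neg_im]
    refine mul_le_mul (Real.exp_le_exp.2 ?_) ?_ (by positivity) (by positivity)
    · rw [mul_neg, neg_neg]
      refine (le_abs_self _).trans ?_
      rw [abs_mul]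
      exact mul_le_mul_of_nonneg_right (Complex.abs_arg_le_pi z) (abs_nonneg _)
    · exact Real.rpow_le_rpow_of_nonpos (by positivity) h (by linarith)

theorem differentiableOn_metricSq_inv (k : Momentum) :
    DifferentiableOn ℂ (fun a => (metricSq a k)⁻¹) Complex.slitPlane := by
  by_cases hk : embed 1 k = 0
  · simp only [metricSq_of_embed_eq_zero hk]
    exact differentiableOn_const _
  · refine DifferentiableOn.fun_inv (by unfold metricSq; fun_prop) fun a ha => ?_
    exact Complex.slitPlane_ne_zero (metricSq_mem_slitPlane ha hk)

theorem differentiableOn_metricSq_cpow (k : Momentum) (s : ℂ) :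
    DifferentiableOn ℂ (fun a => (metricSq a k) ^ s) Complex.slitPlane := by
  by_cases hk : embed 1 k = 0
  · simp only [metricSq_of_embed_eq_zero hk]
    exact differentiableOn_const _
  · intro a ha
    refine DifferentiableAt.differentiableWithinAt ?_
    refine DifferentiableAt.cpow_const (by unfold metricSq; fun_prop) ?_
    exact metricSq_mem_slitPlane ha hk

theorem isPreconnected_slitPlane : IsPreconnected Complex.slitPlane :=
  (Complex.starConvex_one_slitPlane.isPathConnected
    Complex.one_mem_slitPlane).isConnected.isPreconnected

theorem measurable_metricSq (a : ℂ) : Measurable (metricSq a) := by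
  unfold metricSq spatialSq; fun_prop

/-! ### The one-loop integral as a function of the metric -/

/-- The one-loop integrand for the metric `a`. -/
def metricLoop (a ρ : ℂ) (q k : Momentum) : ℂ :=
  (metricSq a k)⁻¹ * (metricSq a (k - q))⁻¹ * metricSq a k ^ (-ρ)

theorem measurable_metricLoop (a ρ : ℂ) (q : Momentum) : Measurable (metricLoop a ρ q) := by
  have := measurable_metricSq a
  unfold metricLoop
  fun_prop

theorem norm_embed_sq_eq_zero {k : Momentum} (a : ℂ) (h : ‖embed 1 k‖ ^ 2 = 0) :
    metricSq a k = 0 :=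
  metricSq_of_embed_eq_zero (norm_eq_zero.1 (pow_eq_zero_iff (two_ne_zero) |>.1 h)) a

theorem exists_metricLoop_bound {ρ : ℂ} (hρ : ρ ∈ mellinStrip) (q : Momentum) {a₀ : ℂ}
    (ha₀ : a₀ ∈ Complex.slitPlane) : ∃ C : ℝ, ∀ᶠ a in 𝓝 a₀, ∀ k,
      ‖metricLoop a ρ q k‖ ≤ C * loopReal ρ.re (embed 1 q) (embed 1 k) := by
  obtain ⟨c, hc, hb⟩ := exists_metricSq_bound ha₀
  refine ⟨c⁻¹ * c⁻¹ * (Real.exp (Real.pi * |ρ.im|) * c ^ (-ρ.re)), ?_⟩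
  filter_upwards [hb] with a ha k
  have e1 := norm_one_div_le_of_bound hc (sq_nonneg _) (norm_embed_sq_eq_zero a) (ha k)
  have e2 := norm_one_div_le_of_bound hc (sq_nonneg _) (norm_embed_sq_eq_zero a) (ha (k - q))
  have e3 := norm_cpow_neg_le_of_bound hc (sq_nonneg _) hρ.1 (norm_embed_sq_eq_zero a) (ha k)
  calc ‖metricLoop a ρ q k‖ = ‖metricSq a k‖⁻¹ * ‖metricSq a (k - q)‖⁻¹ *
        ‖metricSq a k ^ (-ρ)‖ := by rw [metricLoop, norm_mul, norm_mul, norm_inv, norm_inv]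
    _ ≤ (c⁻¹ * (‖embed 1 k‖ ^ 2)⁻¹) * (c⁻¹ * (‖embed 1 (k - q)‖ ^ 2)⁻¹) *
        (Real.exp (Real.pi * |ρ.im|) * c ^ (-ρ.re) * (‖embed 1 k‖ ^ 2) ^ (-ρ.re)) := by gcongr
    _ = _ := by rw [loopReal, embed_sub, div_eq_mul_inv, mul_inv]; ring

theorem embed_ne_zero {q : Momentum} (hq : 0 < spatialSq q) {r : ℝ} (hr : 0 < r) :
    embed r q ≠ 0 := by
  intro h
  have h1 := norm_embed_sq r q
  rw [h, norm_zero] at h1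
  nlinarith [sq_nonneg (q 0), mul_pos (pow_pos hr 2) hq]

theorem integrable_metricLoop {ρ : ℂ} (hρ : ρ ∈ mellinStrip) {q : Momentum}
    (hq : 0 < spatialSq q) {a : ℂ} (ha : a ∈ Complex.slitPlane) :
    Integrable (metricLoop a ρ q) := by
  obtain ⟨C, hC⟩ := exists_metricLoop_bound hρ q ha
  exact ((integrable_comp_embed (integrable_and_integral_loopReal hρ.1 hρ.2
    (embed_ne_zero hq one_pos)).1).const_mul C).mono'
    (measurable_metricLoop a ρ q).aestronglyMeasurable (Eventually.of_forall hC.self_of_nhds)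

theorem ofReal_cpow_sq {x : ℝ} (hx : 0 < x) (s : ℂ) :
    ((x ^ 2 : ℝ) : ℂ) ^ s = (x : ℂ) ^ (2 * s) := by
  rw [pow_two, Complex.ofReal_mul, Complex.mul_cpow_ofReal_nonneg hx.le hx.le,
    ← Complex.cpow_add _ _ (Complex.ofReal_ne_zero.2 hx.ne'), two_mul]

/-- Two functions holomorphic on the slit plane which agree at squares of positive reals are
equal. -/
theorem eqOn_slitPlane_of_sq {f g : ℂ → ℂ} (hf : DifferentiableOn ℂ f Complex.slitPlane)
    (hg : DifferentiableOn ℂ g Complex.slitPlane)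
    (h : ∀ r : ℝ, 0 < r → f ((r ^ 2 : ℝ) : ℂ) = g ((r ^ 2 : ℝ) : ℂ)) :
    Set.EqOn f g Complex.slitPlane := by
  refine eqOn_of_eqOn_real Complex.isOpen_slitPlane isPreconnected_slitPlane hf hg (x₀ := 1)
    (by simp) ?_
  filter_upwards [lt_mem_nhds one_pos] with x hx
  have := h (Real.sqrt x) (Real.sqrt_pos.2 hx)
  rwa [Real.sq_sqrt hx.le] at this

/-- For a = r² the spatial dilation reduces this to the Euclidean integral, and its Jacobian r^(-3)
becomes a^(-3/2). Both sides are holomorphic in a. -/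
theorem integral_metricLoop {ρ : ℂ} (hρ : ρ ∈ mellinStrip) {q : Momentum} (hq : 0 < spatialSq q)
    {a : ℂ} (ha : a ∈ Complex.slitPlane) : ∫ k, metricLoop a ρ q k =
      a ^ (-(3 / 2) : ℂ) * ((Real.pi : ℂ) ^ 2 / (ρ * (1 - ρ)) * metricSq a q ^ (-ρ)) := by
  refine eqOn_slitPlane_of_sq (f := fun a => ∫ k, metricLoop a ρ q k)
    (g := fun a => a ^ (-(3 / 2) : ℂ) * ((Real.pi : ℂ) ^ 2 / (ρ * (1 - ρ)) * metricSq a q ^ (-ρ)))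
    ?_ ?_ (fun r hr => ?_) ha
  · refine differentiableOn_integral_of_dominated Complex.isOpen_slitPlane
      (fun a _ => (measurable_metricLoop a ρ q).aestronglyMeasurable) (fun k => ?_) fun a ha => ?_
    · exact ((differentiableOn_metricSq_inv k).mul (differentiableOn_metricSq_inv (k - q))).mul
        (differentiableOn_metricSq_cpow k (-ρ))
    · obtain ⟨C, hC⟩ := exists_metricLoop_bound hρ q ha
      exact ⟨_, (integrable_comp_embed (integrable_and_integral_loopReal hρ.1 hρ.2
        (embed_ne_zero hq one_pos)).1).const_mul C, hC⟩
  · refine DifferentiableOn.mul ?_ ((differentiableOn_metricSq_cpow q (-ρ)).const_mul _)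
    exact fun a ha => (DifferentiableAt.cpow_const differentiableAt_id ha).differentiableWithinAt
  · have h : ∀ k, metricLoop ((r ^ 2 : ℝ) : ℂ) ρ q k = euclLoop ρ (embed r q) (embed r k) := by
      intro k
      rw [metricLoop, metricSq_sq, metricSq_sq, euclLoop, embed_sub]
      push_cast
      rw [one_div, mul_inv]
    simp_rw [h]
    rw [integral_comp_embed hr (measurable_euclLoop ρ _),
      integral_euclLoop hρ (embed_ne_zero hq hr), metricSq_sq, ofReal_cpow_sq hr,
      show 2 * (-(3 / 2) : ℂ) = -((3 : ℕ) : ℂ) by push_cast; ring, Complex.cpow_neg (r : ℂ),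
      Complex.cpow_natCast]
    push_cast
    ring

/-! ### The two-loop integral as a function of the metric -/

/-- The two-loop weight for the metric `a`. -/
def metricKite (a ρ : ℂ) (q : Momentum) (x : Momentum × Momentum) : ℂ :=
  (metricSq a (x.1 + x.2))⁻¹ * (metricSq a x.2)⁻¹ * (metricSq a (x.1 + q))⁻¹ *
    (metricSq a x.1)⁻¹ * (metricSq a (x.2 - q))⁻¹ * metricSq a (x.2 + x.1) ^ (-ρ)

theorem measurable_metricKite (a ρ : ℂ) (q : Momentum) : Measurable (metricKite a ρ q) := by
  have := measurable_metricSq a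
  unfold metricKite
  fun_prop

theorem exists_metricKite_bound {ρ : ℂ} (hρ : ρ ∈ mellinStrip) (q : Momentum) {a₀ : ℂ}
    (ha₀ : a₀ ∈ Complex.slitPlane) : ∃ C : ℝ, ∀ᶠ a in 𝓝 a₀, ∀ x,
      ‖metricKite a ρ q x‖ ≤ C * kiteReal ρ.re (embed 1 q) (embedPair 1 x) := by
  obtain ⟨c, hc, hb⟩ := exists_metricSq_bound ha₀
  refine ⟨c⁻¹ ^ 5 * (Real.exp (Real.pi * |ρ.im|) * c ^ (-ρ.re)), ?_⟩
  filter_upwards [hb] with a ha x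
  have e : ∀ p, ‖metricSq a p‖⁻¹ ≤ c⁻¹ * (‖embed 1 p‖ ^ 2)⁻¹ := fun p =>
    norm_one_div_le_of_bound hc (sq_nonneg _) (norm_embed_sq_eq_zero a) (ha p)
  have e3 := norm_cpow_neg_le_of_bound hc (sq_nonneg _) hρ.1 (norm_embed_sq_eq_zero a)
    (ha (x.2 + x.1))
  have e4 : ‖-embed 1 x.1 - embed 1 q‖ = ‖embed 1 x.1 + embed 1 q‖ := by
    rw [← norm_neg]; congr 1; abel
  calc ‖metricKite a ρ q x‖ = ‖metricSq a (x.1 + x.2)‖⁻¹ * ‖metricSq a x.2‖⁻¹ *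
        ‖metricSq a (x.1 + q)‖⁻¹ * ‖metricSq a x.1‖⁻¹ * ‖metricSq a (x.2 - q)‖⁻¹ *
        ‖metricSq a (x.2 + x.1) ^ (-ρ)‖ := by
          rw [metricKite]; simp only [norm_mul, norm_inv]
    _ ≤ (c⁻¹ * (‖embed 1 (x.1 + x.2)‖ ^ 2)⁻¹) * (c⁻¹ * (‖embed 1 x.2‖ ^ 2)⁻¹) *
        (c⁻¹ * (‖embed 1 (x.1 + q)‖ ^ 2)⁻¹) * (c⁻¹ * (‖embed 1 x.1‖ ^ 2)⁻¹) *
        (c⁻¹ * (‖embed 1 (x.2 - q)‖ ^ 2)⁻¹) *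
        (Real.exp (Real.pi * |ρ.im|) * c ^ (-ρ.re) * (‖embed 1 (x.2 + x.1)‖ ^ 2) ^ (-ρ.re)) := by
          gcongr <;> exact e _
    _ = _ := by
      rw [kiteReal, embedPair, sub_neg_eq_add, norm_neg, e4, ← embed_add, ← embed_add,
        ← embed_sub, add_comm x.1 x.2, div_eq_mul_inv]
      simp only [mul_inv]
      ring

theorem norm_component_le (k : Momentum) (i : Fin 4) : |k i| ≤ ‖embed 1 k‖ := by
  have h := abs_real_inner_le_norm (EuclideanSpace.single i (1 : ℝ)) (embed 1 k)
  rw [inner_single_embed, PiLp.norm_single, norm_one, one_mul] at h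
  fin_cases i <;> simpa using h

theorem norm_embed_mul_le_momentumSum (q : Momentum) (x : Momentum × Momentum) :
    ‖embed 1 x.2‖ * ‖embed 1 (x.1 + q)‖ ≤ momentumSum (embed 1 q) (embedPair 1 x) := by
  refine le_trans (le_of_eq ?_) (norm_mul_norm_le_momentumSum _ _)
  rw [embedPair, sub_neg_eq_add, embed_add, add_comm]

/-- Measurable numerators bounded by the product of the norms of `l` and `k + q` give integrable
two-loop integrands, locally uniformly in the metric. -/
theorem exists_metricKite_mul_bound {ρ : ℂ} (hρ : ρ ∈ mellinStrip) {q : Momentum}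
    (hq : 0 < spatialSq q) {a₀ : ℂ} (ha₀ : a₀ ∈ Complex.slitPlane)
    {n : Momentum × Momentum → ℂ} {B : ℝ}
    (hB : ∀ x, ‖n x‖ ≤ B * (‖embed 1 x.2‖ * ‖embed 1 (x.1 + q)‖)) :
    ∃ bound : Momentum × Momentum → ℝ, Integrable bound ∧
      ∀ᶠ a in 𝓝 a₀, ∀ x, ‖metricKite a ρ q x * n x‖ ≤ bound x := by
  obtain ⟨C, hC⟩ := exists_metricKite_bound hρ q ha₀
  refine ⟨fun x => |C| * |B| * (momentumSum (embed 1 q) (embedPair 1 x) *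
    kiteReal ρ.re (embed 1 q) (embedPair 1 x)), (integrable_comp_embedPair
    (integrable_momentumSum_mul_kiteReal hρ.1 hρ.2 (embed_ne_zero hq one_pos))).const_mul _, ?_⟩
  filter_upwards [hC] with a ha x
  have h1 := kiteReal_nonneg ρ.re (embed 1 q) (embedPair 1 x)
  have h2 := norm_embed_mul_le_momentumSum q x
  rw [norm_mul]
  calc _ ≤ (|C| * kiteReal ρ.re (embed 1 q) (embedPair 1 x)) *
        (|B| * momentumSum (embed 1 q) (embedPair 1 x)) := by
        refine mul_le_mul ((ha x).trans ?_) ((hB x).trans ?_) (norm_nonneg _) (by positivity)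
        · gcongr; exact le_abs_self C
        · refine mul_le_mul (le_abs_self B) h2 (by positivity) (abs_nonneg _)
    _ = _ := by ring

theorem integrable_metricKite_mul {ρ : ℂ} (hρ : ρ ∈ mellinStrip) {q : Momentum}
    (hq : 0 < spatialSq q) {a : ℂ} (ha : a ∈ Complex.slitPlane)
    {n : Momentum × Momentum → ℂ} (hn : Measurable n) {B : ℝ}
    (hB : ∀ x, ‖n x‖ ≤ B * (‖embed 1 x.2‖ * ‖embed 1 (x.1 + q)‖)) :
    Integrable fun x => metricKite a ρ q x * n x := by
  obtain ⟨b, hb, hab⟩ := exists_metricKite_mul_bound hρ hq ha hB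
  exact hb.mono' ((measurable_metricKite a ρ q).mul hn).aestronglyMeasurable
    (Eventually.of_forall hab.self_of_nhds)

/-- The product of the `i`-th components of `l` and `k + q`. -/
def componentProduct (q : Momentum) (i : Fin 4) (x : Momentum × Momentum) : ℂ :=
  ((x.2 i * (x.1 i + q i) : ℝ) : ℂ)

theorem measurable_componentProduct (q : Momentum) (i : Fin 4) :
    Measurable (componentProduct q i) := by
  unfold componentProduct; fun_prop

theorem norm_componentProduct_le (q : Momentum) (i : Fin 4) (x : Momentum × Momentum) :
    ‖componentProduct q i x‖ ≤ 1 * (‖embed 1 x.2‖ * ‖embed 1 (x.1 + q)‖) := by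
  rw [componentProduct, Complex.norm_real, Real.norm_eq_abs, abs_mul, one_mul]
  exact mul_le_mul (norm_component_le _ _) (norm_component_le (x.1 + q) i) (abs_nonneg _)
    (norm_nonneg _)

/-- The diagonal coefficients of the quadratic form `metricSq a`. -/
def metricCoeff (a : ℂ) (i : Fin 4) : ℂ := ![1, a, a, a] i

theorem metricCoeff_sq (r : ℝ) (i : Fin 4) :
    metricCoeff ((r ^ 2 : ℝ) : ℂ) i = ((![1, r, r, r] i ^ 2 : ℝ) : ℂ) := by
  fin_cases i <;> simp [metricCoeff]

theorem metricCoeff_ne_zero {a : ℂ} (ha : a ≠ 0) (i : Fin 4) : metricCoeff a i ≠ 0 := by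
  fin_cases i <;> simp [metricCoeff, ha]

/-- Continued one component at a time, because the Dirac numerator contracts with the fixed
Minkowski metric and not with the metric a. At a = r² the two Jacobians give a^(-3), and undoing the
dilation of the i-th component twice gives the inverse coefficient. -/
theorem integral_metricKite_mul_componentProduct {ρ : ℂ} (hρ : ρ ∈ mellinStrip) {q : Momentum}
    (hq : 0 < spatialSq q) (i : Fin 4) {a : ℂ} (ha : a ∈ Complex.slitPlane) :
    ∫ x, metricKite a ρ q x * componentProduct q i x = (a ^ 3)⁻¹ * (metricSq a q ^ (-ρ) *
      (tensorTrans ρ * (metricCoeff a i)⁻¹ +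
        (tensorLong ρ - tensorTrans ρ) * ((q i : ℂ) ^ 2 * (metricSq a q)⁻¹))) := by
  refine eqOn_slitPlane_of_sq (f := fun a => ∫ x, metricKite a ρ q x * componentProduct q i x)
    (g := fun a => (a ^ 3)⁻¹ * (metricSq a q ^ (-ρ) * (tensorTrans ρ * (metricCoeff a i)⁻¹ +
        (tensorLong ρ - tensorTrans ρ) * ((q i : ℂ) ^ 2 * (metricSq a q)⁻¹))))
    ?_ ?_ (fun r hr => ?_) ha
  · refine differentiableOn_integral_of_dominated Complex.isOpen_slitPlane (fun a _ =>
      ((measurable_metricKite a ρ q).mul (measurable_componentProduct q i)).aestronglyMeasurable)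
      (fun x => ?_) fun a ha => exists_metricKite_mul_bound hρ hq ha (norm_componentProduct_le q i)
    have hd := differentiableOn_metricSq_inv
    exact ((((((hd _).mul (hd _)).mul (hd _)).mul (hd _)).mul (hd _)).mul
        (differentiableOn_metricSq_cpow _ (-ρ))).mul_const _
  · have h0 : ∀ a ∈ Complex.slitPlane, a ≠ 0 := fun a ha => Complex.slitPlane_ne_zero ha
    refine DifferentiableOn.mul (DifferentiableOn.fun_inv (by fun_prop)
      fun a ha => pow_ne_zero 3 (h0 a ha)) ?_
    refine (differentiableOn_metricSq_cpow q (-ρ)).mul (DifferentiableOn.add ?_ ?_)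
    · refine (DifferentiableOn.fun_inv ?_ fun a ha => metricCoeff_ne_zero (h0 a ha) i).const_mul _
      fin_cases i <;> simp [metricCoeff] <;> fun_prop
    · exact ((differentiableOn_metricSq_inv q).const_mul _).const_mul _
  · set d : ℝ := ![1, r, r, r] i with hd
    have hd0 : d ≠ 0 := by
      rw [hd]; fin_cases i <;> simp [hr.ne']
    -- The sign reversal of k in `embedPair` turns k + l and k + q into the kite momenta l - k and k
    -- - q, up to sign.
    have h : ∀ x, metricKite ((r ^ 2 : ℝ) : ℂ) ρ q x * componentProduct q i x =
        ((d ^ 2)⁻¹ : ℝ) * (euclKite ρ (embed r q) (embedPair r x) *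
          ((⟪EuclideanSpace.single i (1 : ℝ), (embedPair r x).2⟫_ℝ *
          ⟪EuclideanSpace.single i (1 : ℝ), embed r q - (embedPair r x).1⟫_ℝ : ℝ) : ℂ)) := by
      intro x
      have e4 : ‖-embed r x.1 - embed r q‖ = ‖embed r x.1 + embed r q‖ := by
        rw [← norm_neg]; congr 1; abel
      simp only [embedPair, sub_neg_eq_add]
      rw [← embed_add, inner_single_embed, inner_single_embed, ← hd]
      simp only [metricKite, metricSq_sq, euclKite, componentProduct, sub_neg_eq_add, norm_neg, e4,
        ← embed_add, ← embed_sub, add_comm x.2 x.1, Pi.add_apply]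
      have hdc : (d : ℂ) ≠ 0 := Complex.ofReal_ne_zero.2 hd0
      push_cast
      simp only [one_div, mul_inv]
      field_simp
      ring
    have hm := measurable_euclKite ρ (embed r q)
    simp_rw [h]
    rw [integral_const_mul, integral_comp_embedPair hr (f := fun x => euclKite ρ (embed r q) x *
          ((⟪EuclideanSpace.single i (1 : ℝ), x.2⟫_ℝ *
          ⟪EuclideanSpace.single i (1 : ℝ), embed r q - x.1⟫_ℝ : ℝ) : ℂ)) (by fun_prop),
      ← twoLoopTensor, twoLoopTensor_eq hρ _ (embed_ne_zero hq hr), metricSq_sq, metricCoeff_sq,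
      ← hd, inner_single_embed, ← hd, PiLp.norm_single, norm_one]
    have hdc : (d : ℂ) ≠ 0 := Complex.ofReal_ne_zero.2 hd0
    push_cast
    field_simp

/-! ### The Feynman metric and the phases of complex powers -/

/-- The metric parameter which corresponds to the `+i0` prescription. -/
def feynMetric (ε : ℝ) : ℂ := -1 + Complex.I * ε

theorem feynSq_eq_metricSq (ε : ℝ) (k : Momentum) : feynSq ε k = metricSq (feynMetric ε) k := by
  unfold feynSq metricSq feynMetric minkSq
  push_cast
  ring

theorem feynMetric_mem_slitPlane {ε : ℝ} (hε : 0 < ε) : feynMetric ε ∈ Complex.slitPlane := by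
  rw [Complex.mem_slitPlane_iff]
  right
  simp [feynMetric, hε.ne']

theorem feynSq_im (ε : ℝ) (k : Momentum) : (feynSq ε k).im = ε * spatialSq k := by
  simp [feynSq]

/-- Negating a point of the upper half plane lowers its principal argument by π. -/
theorem log_div_ofReal_neg {z : ℂ} (hz : 0 < z.im) {m : ℝ} (hm : 0 < m) :
    Complex.log (z / ((-m : ℝ) : ℂ)) = Complex.log z - (Real.log m + Real.pi * Complex.I) := by
  have h1 : z / ((-m : ℝ) : ℂ) = ((m⁻¹ : ℝ) : ℂ) * (-z) := by
    push_cast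
    field_simp
  have hz0 : z ≠ 0 := fun h => by simp [h] at hz
  rw [h1, Complex.log_ofReal_mul (inv_pos.2 hm) (neg_ne_zero.2 hz0), Real.log_inv]
  have h2 : Complex.log (-z) = Complex.log z - Real.pi * Complex.I := by
    rw [Complex.log, Complex.log, norm_neg, Complex.arg_neg_eq_arg_sub_pi_of_im_pos hz]
    push_cast
    ring
  rw [h2]
  push_cast
  ring

/-- The phase by which the complex power of a quotient differs from that of the numerator. -/
def powerPhase (ρ : ℂ) (m : ℝ) : ℂ := Complex.exp (ρ * (Real.log m + Real.pi * Complex.I))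

theorem div_cpow_eq {z : ℂ} (hz : 0 < z.im) {m : ℝ} (hm : 0 < m) (ρ : ℂ) :
    (z / ((-m : ℝ) : ℂ)) ^ (-ρ) = powerPhase ρ m * z ^ (-ρ) := by
  have hz0 : z ≠ 0 := fun h => by simp [h] at hz
  have hm0 : ((-m : ℝ) : ℂ) ≠ 0 := Complex.ofReal_ne_zero.2 (neg_ne_zero.2 hm.ne')
  rw [Complex.cpow_def_of_ne_zero (div_ne_zero hz0 hm0), Complex.cpow_def_of_ne_zero hz0,
    log_div_ofReal_neg hz hm, powerPhase, ← Complex.exp_add]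
  congr 1
  ring

theorem ae_spatialSq_pos : ∀ᵐ k : Momentum, 0 < spatialSq k := by
  have h : ∀ᵐ k : Momentum, k 1 ≠ 0 := Measure.ae_eval_ne (fun _ => volume) 1 0
  filter_upwards [h] with k hk
  have : 0 < k 1 ^ 2 := by positivity
  unfold spatialSq
  positivity

/-- Off this null set the base of the power has positive imaginary part, as the phase formula
requires. -/
theorem ae_spatialSq_add_pos : ∀ᵐ x : Momentum × Momentum, 0 < spatialSq (x.2 + x.1) := by
  have h : Measure.QuasiMeasurePreserving (fun x : Momentum × Momentum => x.1 + x.2) :=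
    Measure.quasiMeasurePreserving_fst.comp
      (measurePreserving_add_prod (volume : Measure Momentum) volume).quasiMeasurePreserving
  filter_upwards [h.ae ae_spatialSq_pos] with x hx
  rwa [add_comm]

/-! ### Limits as `ε → 0⁺` -/

theorem tendsto_feynMetric : Tendsto feynMetric (𝓝[>] 0) (𝓝 (-1)) := by
  have h : Continuous feynMetric := by unfold feynMetric; fun_prop
  have h2 := h.tendsto 0
  rw [show feynMetric 0 = -1 by simp [feynMetric]] at h2
  exact h2.mono_left nhdsWithin_le_nhds

/-- The principal logarithm is continuous at the cut from the closed upper half plane, with argument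
π there. -/
theorem tendsto_log_of_im_nonneg {f : ℝ → ℂ} {m : ℝ} (hm : 0 < m)
    (hf : Tendsto f (𝓝[>] 0) (𝓝 ((-m : ℝ) : ℂ))) (him : ∀ ε : ℝ, 0 < ε → 0 ≤ (f ε).im) :
    Tendsto (fun ε => Complex.log (f ε)) (𝓝[>] 0) (𝓝 (Real.log m + Real.pi * Complex.I)) := by
  have h := (Complex.continuousWithinAt_log_of_re_neg_of_im_zero (z := ((-m : ℝ) : ℂ))
    (by simpa using hm) (Complex.ofReal_im _)).tendsto
  have h2 : Complex.log ((-m : ℝ) : ℂ) = Real.log m + Real.pi * Complex.I := by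
    rw [Complex.log, Complex.arg_ofReal_of_neg (by linarith), Complex.norm_real, norm_neg,
      Real.norm_of_nonneg hm.le]
  rw [h2] at h
  refine h.comp (tendsto_nhdsWithin_iff.2 ⟨hf, ?_⟩)
  filter_upwards [self_mem_nhdsWithin] with ε hε using him ε hε

theorem tendsto_cpow_of_im_nonneg {f : ℝ → ℂ} {m : ℝ} (hm : 0 < m)
    (hf : Tendsto f (𝓝[>] 0) (𝓝 ((-m : ℝ) : ℂ))) (him : ∀ ε : ℝ, 0 < ε → 0 ≤ (f ε).im) (s : ℂ) :
    Tendsto (fun ε => f ε ^ s) (𝓝[>] 0)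
      (𝓝 (Complex.exp ((Real.log m + Real.pi * Complex.I) * s))) := by
  have h := (Complex.continuous_exp.tendsto _).comp
    ((tendsto_log_of_im_nonneg hm hf him).mul_const s)
  refine h.congr' ?_
  have hne : ∀ᶠ ε in 𝓝[>] 0, f ε ≠ 0 :=
    hf.eventually_ne (Complex.ofReal_ne_zero.2 (neg_ne_zero.2 hm.ne'))
  filter_upwards [hne] with ε hε
  rw [Complex.cpow_def_of_ne_zero hε, Function.comp_apply]

theorem tendsto_feynSq (q : Momentum) :
    Tendsto (fun ε => feynSq ε q) (𝓝[>] 0) (𝓝 (minkSq q : ℂ)) := by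
  have h : Continuous fun ε => feynSq ε q := by unfold feynSq; fun_prop
  have h2 := h.tendsto 0
  rw [show feynSq 0 q = (minkSq q : ℂ) by simp [feynSq]] at h2
  exact h2.mono_left nhdsWithin_le_nhds

/-- The phase from dividing by q² and the boundary value of the power of q² are inverse to each
other; hence the limits are independent of q. -/
theorem tendsto_phase_mul_feynSq_cpow {q : Momentum} (hq : minkSq q < 0) (ρ : ℂ) :
    Tendsto (fun ε => powerPhase ρ (-minkSq q) * feynSq ε q ^ (-ρ)) (𝓝[>] 0) (𝓝 1) := by
  have hm : 0 < -minkSq q := neg_pos.2 hq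
  have h := (tendsto_cpow_of_im_nonneg hm (by simpa using tendsto_feynSq q)
    (fun ε hε => by
      rw [feynSq_im]; exact mul_nonneg hε.le (spatialSq_nonneg q)) (-ρ)).const_mul
      (powerPhase ρ (-minkSq q))
  convert h using 2
  rw [powerPhase, ← Complex.exp_add, ← Complex.exp_zero]
  congr 1
  ring

/-- From above the cut, (-1)^(-3/2) = exp(-3πi/2) = i. This is the i removed by the normalisation
1/(iπ²). -/
theorem tendsto_feynMetric_cpow :
    Tendsto (fun ε => feynMetric ε ^ (-(3 / 2) : ℂ)) (𝓝[>] 0) (𝓝 Complex.I) := by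
  have h := tendsto_cpow_of_im_nonneg one_pos (by simpa using tendsto_feynMetric)
    (fun ε hε => by simp [feynMetric, hε.le]) (-(3 / 2) : ℂ)
  convert h using 2
  rw [Real.log_one, show ((0 : ℝ) + Real.pi * Complex.I) * (-(3 / 2) : ℂ) =
    Real.pi / 2 * Complex.I - 2 * Real.pi * Complex.I by push_cast; ring, Complex.exp_sub,
    Complex.exp_two_pi_mul_I, Complex.exp_pi_div_two_mul_I, div_one]

theorem spatialSq_pos_of_minkSq_neg {q : Momentum} (hq : minkSq q < 0) : 0 < spatialSq q := by
  unfold minkSq at hq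
  nlinarith [sq_nonneg (q 0)]

/-! ### The one-loop Mellin transform -/

theorem oneLoopIntegrand_ae_eq {q : Momentum} (hq : minkSq q < 0) (ρ : ℂ) {ε : ℝ} (hε : 0 < ε) :
    oneLoopIntegrand q ρ ε =ᵐ[volume] fun k =>
      -(1 / (Complex.I * (Real.pi : ℂ) ^ 2)) * powerPhase ρ (-minkSq q) *
        metricLoop (feynMetric ε) ρ q k := by
  filter_upwards [ae_spatialSq_pos] with k hk
  have h := div_cpow_eq (z := feynSq ε k) (by rw [feynSq_im]; positivity) (neg_pos.2 hq) ρ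
  rw [neg_neg] at h
  rw [oneLoopIntegrand, h, metricLoop, ← feynSq_eq_metricSq, ← feynSq_eq_metricSq, one_div (_ * _),
    mul_inv]
  ring

theorem isOneLoopMellin {q : Momentum} (hq : minkSq q < 0) {ρ : ℂ} (hρ : ρ ∈ mellinStrip) :
    IsOneLoopMellin q ρ (-1 / (ρ * (1 - ρ))) := by
  have hs := spatialSq_pos_of_minkSq_neg hq
  refine ⟨fun ε hε => ?_, ?_⟩
  · exact ((integrable_metricLoop hρ hs (feynMetric_mem_slitPlane hε)).const_mul _).congr
      (oneLoopIntegrand_ae_eq hq ρ hε).symm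
  · have h := (tendsto_feynMetric_cpow.mul (tendsto_phase_mul_feynSq_cpow hq ρ)).const_mul
      (-(1 / (Complex.I * (Real.pi : ℂ) ^ 2)) * ((Real.pi : ℂ) ^ 2 / (ρ * (1 - ρ))))
    have hpi : (Real.pi : ℂ) ≠ 0 := Complex.ofReal_ne_zero.2 Real.pi_ne_zero
    have hval : -(1 / (Complex.I * (Real.pi : ℂ) ^ 2)) * ((Real.pi : ℂ) ^ 2 / (ρ * (1 - ρ))) *
        (Complex.I * 1) = -1 / (ρ * (1 - ρ)) := by
      have h1 := ne_zero_of_mem_mellinStrip hρ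
      have h2 := ne_zero_of_mem_mellinStrip (one_sub_mem_mellinStrip hρ)
      field_simp
    rw [hval] at h
    refine h.congr' ?_
    filter_upwards [self_mem_nhdsWithin] with ε hε
    rw [integral_congr_ae (oneLoopIntegrand_ae_eq hq ρ hε), integral_const_mul,
      integral_metricLoop hρ hs (feynMetric_mem_slitPlane hε), ← feynSq_eq_metricSq]
    ring

/-! ### The two-loop Mellin transform -/

/-- The Minkowski inner product. -/
def minkInner (k l : Momentum) : ℝ := k 0 * l 0 - (k 1 * l 1 + k 2 * l 2 + k 3 * l 3)

theorem slash_add (k l : Momentum) : slash (k + l) = slash k + slash l := by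
  simp only [slash, Pi.add_apply, Complex.ofReal_add, add_smul]
  abel

/-- Polarisation of the Clifford relation. -/
theorem slash_anticomm (k l : Momentum) : slash k * slash l + slash l * slash k =
    ((2 * minkInner k l : ℝ) : ℂ) • (1 : Matrix (Fin 4) (Fin 4) ℂ) := by
  have h := slash_mul_self (k + l)
  rw [slash_add, add_mul, mul_add, mul_add, slash_mul_self, slash_mul_self] at h
  have h2 : ((2 * minkInner k l : ℝ) : ℂ) = (minkSq (k + l) : ℂ) - minkSq k - minkSq l := by
    simp only [minkInner, minkSq, spatialSq, Pi.add_apply]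
    push_cast
    ring
  rw [h2, sub_smul, sub_smul, ← h]
  abel

theorem norm_slash_apply_le (k : Momentum) (a b : Fin 4) : ‖slash k a b‖ ≤ 4 * ‖embed 1 k‖ := by
  have hg : ∀ i, ‖diracGamma i a b‖ ≤ 1 := by
    intro i
    fin_cases i <;> fin_cases a <;> fin_cases b <;> simp [diracGamma]
  have ht : ∀ i, ‖(k i : ℂ) * diracGamma i a b‖ ≤ ‖embed 1 k‖ := by
    intro i
    rw [norm_mul, Complex.norm_real]
    calc ‖k i‖ * ‖diracGamma i a b‖ ≤ ‖embed 1 k‖ * 1 :=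
          mul_le_mul (norm_component_le k i) (hg i) (norm_nonneg _) (norm_nonneg _)
      _ = _ := mul_one _
  have hs : slash k a b = (k 0 : ℂ) * diracGamma 0 a b - (k 1 : ℂ) * diracGamma 1 a b -
      (k 2 : ℂ) * diracGamma 2 a b - (k 3 : ℂ) * diracGamma 3 a b := by
    simp [slash]
  rw [hs]
  refine (norm_sub_le _ _).trans ?_
  have h1 := norm_sub_le ((k 0 : ℂ) * diracGamma 0 a b - (k 1 : ℂ) * diracGamma 1 a b)
    ((k 2 : ℂ) * diracGamma 2 a b)
  have h2 := norm_sub_le ((k 0 : ℂ) * diracGamma 0 a b) ((k 1 : ℂ) * diracGamma 1 a b)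
  linarith [ht 0, ht 1, ht 2, ht 3]

/-- The matrix numerator of the two-loop integral. -/
def slashNumerator (q : Momentum) (a b : Fin 4) (x : Momentum × Momentum) : ℂ :=
  (slash x.2 * slash (x.1 + q)) a b

theorem measurable_slash_apply (a b : Fin 4) : Measurable fun k : Momentum => slash k a b := by
  simp only [slash, Matrix.sub_apply, Matrix.smul_apply]
  fun_prop

theorem measurable_slashNumerator (q : Momentum) (a b : Fin 4) :
    Measurable (slashNumerator q a b) := by
  have := measurable_slash_apply
  unfold slashNumerator
  simp only [Matrix.mul_apply]
  fun_prop

theorem norm_slashNumerator_le (q : Momentum) (a b : Fin 4) (x : Momentum × Momentum) :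
    ‖slashNumerator q a b x‖ ≤ 64 * (‖embed 1 x.2‖ * ‖embed 1 (x.1 + q)‖) := by
  rw [slashNumerator, Matrix.mul_apply]
  calc _ ≤ ∑ j : Fin 4, (4 * ‖embed 1 x.2‖) * (4 * ‖embed 1 (x.1 + q)‖) := by
        refine norm_sum_le_of_le _ fun j _ => ?_
        rw [norm_mul]
        exact mul_le_mul (norm_slash_apply_le _ _ _) (norm_slash_apply_le _ _ _)
          (norm_nonneg _) (by positivity)
    _ = _ := by
        rw [Finset.sum_const, Finset.card_univ, Fintype.card_fin, nsmul_eq_mul]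
        push_cast
        ring

/-- The symmetry of the two-loop diagram which exchanges the two fermion lines. -/
def exchange (q : Momentum) (x : Momentum × Momentum) : Momentum × Momentum := (x.2 - q, x.1 + q)

theorem measurePreserving_exchange (q : Momentum) : MeasurePreserving (exchange q) :=
  ((measurePreserving_sub_right volume q).prod (measurePreserving_add_right volume q)).comp
    Measure.measurePreserving_swap

theorem measurableEmbedding_exchange (q : Momentum) : MeasurableEmbedding (exchange q) :=
  (((Homeomorph.prodComm Momentum Momentum).trans
    ((Homeomorph.subRight q).prodCongr (Homeomorph.addRight q)))).measurableEmbedding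

theorem metricKite_exchange (a ρ : ℂ) (q : Momentum) (x : Momentum × Momentum) :
    metricKite a ρ q (exchange q x) = metricKite a ρ q x := by
  simp only [metricKite, exchange, sub_add_cancel, add_sub_cancel_right]
  rw [show x.2 - q + (x.1 + q) = x.1 + x.2 by abel, show x.1 + q + (x.2 - q) = x.2 + x.1 by abel]
  ring

theorem minkInner_eq (q : Momentum) (x : Momentum × Momentum) :
    ((minkInner x.2 (x.1 + q) : ℝ) : ℂ) = componentProduct q 0 x - (componentProduct q 1 x +
      componentProduct q 2 x + componentProduct q 3 x) := by
  simp only [minkInner, componentProduct, Pi.add_apply]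
  push_cast
  ring

/-- The exchange l ↔ k + q preserves the weight and reverses the order of the two slashed factors.
Averaging leaves half their anticommutator, a Minkowski product times the unit matrix, and the
component integrals are summed with signs +, -, -, -. -/
theorem integral_metricKite_mul_slashNumerator {ρ : ℂ} (hρ : ρ ∈ mellinStrip) {q : Momentum}
    (hq : 0 < spatialSq q) {a : ℂ} (ha : a ∈ Complex.slitPlane) (i j : Fin 4) :
    ∫ x, metricKite a ρ q x * slashNumerator q i j x =
      (1 : Matrix (Fin 4) (Fin 4) ℂ) i j * ((a ^ 3)⁻¹ * metricSq a q ^ (-ρ) *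
        (tensorTrans ρ * (1 - 3 * a⁻¹) +
          (tensorLong ρ - tensorTrans ρ) * (minkSq q * (metricSq a q)⁻¹))) := by
  set I := ∫ x, metricKite a ρ q x * slashNumerator q i j x with hI
  have hex : I = ∫ x, metricKite a ρ q x * slashNumerator q i j (exchange q x) := by
    rw [hI, ← (measurePreserving_exchange q).integral_comp (measurableEmbedding_exchange q)]
    simp only [metricKite_exchange]
  have hint := integrable_metricKite_mul hρ hq ha (measurable_slashNumerator q i j)
    (norm_slashNumerator_le q i j)
  have hint2 : Integrable fun x => metricKite a ρ q x * slashNumerator q i j (exchange q x) := by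
    have := (measurePreserving_exchange q).integrable_comp_of_integrable hint
    simpa only [Function.comp_def, metricKite_exchange] using this
  have hc := fun c => integrable_metricKite_mul hρ hq ha (measurable_componentProduct q c)
    (norm_componentProduct_le q c)
  have hpt : ∀ x, metricKite a ρ q x * slashNumerator q i j x +
      metricKite a ρ q x * slashNumerator q i j (exchange q x) =
      2 * (1 : Matrix (Fin 4) (Fin 4) ℂ) i j * (metricKite a ρ q x * componentProduct q 0 x -
        (metricKite a ρ q x * componentProduct q 1 x +
          metricKite a ρ q x * componentProduct q 2 x +
          metricKite a ρ q x * componentProduct q 3 x)) := by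
    intro x
    have h := congrFun (congrFun (slash_anticomm x.2 (x.1 + q)) i) j
    rw [Matrix.add_apply, Matrix.smul_apply, smul_eq_mul] at h
    simp only [slashNumerator, exchange, sub_add_cancel]
    rw [← mul_add, h, Complex.ofReal_mul, minkInner_eq]
    push_cast
    ring
  have hsum : I + I = 2 * (1 : Matrix (Fin 4) (Fin 4) ℂ) i j *
      ((∫ x, metricKite a ρ q x * componentProduct q 0 x) -
        ((∫ x, metricKite a ρ q x * componentProduct q 1 x) +
          (∫ x, metricKite a ρ q x * componentProduct q 2 x) +
          ∫ x, metricKite a ρ q x * componentProduct q 3 x)) := by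
    have hadd : I + I = ∫ x, (metricKite a ρ q x * slashNumerator q i j x +
        metricKite a ρ q x * slashNumerator q i j (exchange q x)) := by
      rw [integral_add hint hint2, ← hex]
    rw [hadd]
    simp_rw [hpt]
    rw [integral_const_mul]
    congr 1
    have e1 := integral_sub (hc 0) (((hc 1).add (hc 2)).add (hc 3))
    have e2 := integral_add ((hc 1).add (hc 2)) (hc 3)
    have e3 := integral_add (hc 1) (hc 2)
    simp only [Pi.add_apply] at e1 e2 e3
    rw [e1, e2, e3]
  have hI2 : I = (1 : Matrix (Fin 4) (Fin 4) ℂ) i j *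
      ((∫ x, metricKite a ρ q x * componentProduct q 0 x) -
        ((∫ x, metricKite a ρ q x * componentProduct q 1 x) +
          (∫ x, metricKite a ρ q x * componentProduct q 2 x) +
          ∫ x, metricKite a ρ q x * componentProduct q 3 x)) := by
    linear_combination (1 / 2 : ℂ) * hsum
  rw [hI2]
  simp only [integral_metricKite_mul_componentProduct hρ hq _ ha]
  rw [show metricCoeff a 0 = 1 from rfl, show metricCoeff a 1 = a from rfl,
    show metricCoeff a 2 = a from rfl, show metricCoeff a 3 = a from rfl]
  simp only [minkSq, spatialSq]
  push_cast
  ring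

theorem twoLoopIntegrand_ae_eq {q : Momentum} (hq : minkSq q < 0) (ρ : ℂ) {ε : ℝ} (hε : 0 < ε)
    (a b : Fin 4) : (fun x => twoLoopIntegrand q ρ ε x a b) =ᵐ[volume] fun x =>
      (1 / (Complex.I * (Real.pi : ℂ) ^ 2)) ^ 2 * powerPhase ρ (-minkSq q) *
        (metricKite (feynMetric ε) ρ q x * slashNumerator q a b x) := by
  filter_upwards [ae_spatialSq_add_pos] with x hx
  have h := div_cpow_eq (z := feynSq ε (x.2 + x.1)) (by rw [feynSq_im]; positivity)
    (neg_pos.2 hq) ρ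
  rw [neg_neg] at h
  rw [twoLoopIntegrand, h, Matrix.smul_apply, smul_eq_mul, metricKite, slashNumerator, slash_add]
  simp only [← feynSq_eq_metricSq, one_div (_ * feynSq ε (x.2 - q)), mul_inv]
  ring

/-- The two-loop Mellin transform as a Euclidean integral. -/
def twoLoopMellin (ρ : ℂ) : ℂ := 1 / (Real.pi : ℂ) ^ 4 * euclTwoLoop ρ timeVec

theorem isTwoLoopMellin {q : Momentum} (hq : minkSq q < 0) {ρ : ℂ} (hρ : ρ ∈ mellinStrip) :
    IsTwoLoopMellin q ρ (twoLoopMellin ρ) := by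
  have hs := spatialSq_pos_of_minkSq_neg hq
  intro i j
  refine ⟨fun ε hε => ?_, ?_⟩
  · exact ((integrable_metricKite_mul hρ hs (feynMetric_mem_slitPlane hε)
      (measurable_slashNumerator q i j) (norm_slashNumerator_le q i j)).const_mul _).congr
      (twoLoopIntegrand_ae_eq hq ρ hε i j).symm
  · have hq0 : (minkSq q : ℂ) ≠ 0 := Complex.ofReal_ne_zero.2 hq.ne
    have h1 : Tendsto (fun ε => (feynMetric ε ^ 3)⁻¹) (𝓝[>] 0) (𝓝 ((-1) ^ 3)⁻¹) :=
      (tendsto_feynMetric.pow 3).inv₀ (by norm_num)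
    have h2 : Tendsto (fun ε => tensorTrans ρ * (1 - 3 * (feynMetric ε)⁻¹) +
        (tensorLong ρ - tensorTrans ρ) * (minkSq q * (feynSq ε q)⁻¹)) (𝓝[>] 0)
        (𝓝 (tensorTrans ρ * (1 - 3 * (-1)⁻¹) +
          (tensorLong ρ - tensorTrans ρ) * (minkSq q * (minkSq q : ℂ)⁻¹))) :=
      ((((tendsto_feynMetric.inv₀ (by norm_num)).const_mul 3).const_sub 1).const_mul _).add
        ((((tendsto_feynSq q).inv₀ hq0).const_mul _).const_mul _)
    have h := ((h1.mul (tendsto_phase_mul_feynSq_cpow hq ρ)).mul h2).const_mul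
      ((1 / (Complex.I * (Real.pi : ℂ) ^ 2)) ^ 2 * (1 : Matrix (Fin 4) (Fin 4) ℂ) i j)
    -- At a = -1 the factor 1 - 3/a is 4, so the bracket becomes 4T + (L - T) = L + 3T, the
    -- Euclidean trace. The signs of a^(-3) and of 1/i² cancel.
    have hval : (1 / (Complex.I * (Real.pi : ℂ) ^ 2)) ^ 2 * (1 : Matrix (Fin 4) (Fin 4) ℂ) i j *
        (((-1) ^ 3)⁻¹ * 1 * (tensorTrans ρ * (1 - 3 * (-1)⁻¹) +
          (tensorLong ρ - tensorTrans ρ) * (minkSq q * (minkSq q : ℂ)⁻¹))) =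
        (twoLoopMellin ρ • (1 : Matrix (Fin 4) (Fin 4) ℂ)) i j := by
      rw [Matrix.smul_apply, smul_eq_mul, twoLoopMellin, euclTwoLoop_eq hρ, mul_inv_cancel₀ hq0,
        div_pow, mul_pow, Complex.I_sq]
      ring
    rw [hval] at h
    refine h.congr' ?_
    filter_upwards [self_mem_nhdsWithin] with ε hε
    rw [integral_congr_ae (twoLoopIntegrand_ae_eq hq ρ hε i j), integral_const_mul,
      integral_metricKite_mul_slashNumerator hρ hs (feynMetric_mem_slitPlane hε),
      ← feynSq_eq_metricSq]
    ring


end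

theorem mainTheorem1 :
    ∃ F₁ F₂ : ℂ → ℂ,
      (∀ q : Momentum, minkSq q < 0 → ∀ ρ ∈ mellinStrip,
        IsOneLoopMellin q ρ (F₁ ρ) ∧ IsTwoLoopMellin q ρ (F₂ ρ)) ∧
      DifferentiableOn ℂ F₁ mellinStrip ∧
      DifferentiableOn ℂ F₂ mellinStrip ∧
      IsReflectionInvariant F₁ ∧
      IsReflectionInvariant F₂ ∧
      ∀ ρ ∈ mellinStrip, F₁ ρ = -1 / (ρ * (1 - ρ)) := by
  have h1 : DifferentiableOn ℂ (fun ρ : ℂ => -1 / (ρ * (1 - ρ))) mellinStrip :=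
    DifferentiableOn.div (by fun_prop) (by fun_prop) fun z hz =>
      mul_ne_zero (ne_zero_of_mem_mellinStrip hz)
        (ne_zero_of_mem_mellinStrip (one_sub_mem_mellinStrip hz))
  have h2 : DifferentiableOn ℂ twoLoopMellin mellinStrip :=
    (differentiableOn_euclTwoLoop timeVec_ne_zero).const_mul _
  refine ⟨fun ρ => -1 / (ρ * (1 - ρ)), twoLoopMellin,
    fun q hq ρ hρ => ⟨isOneLoopMellin hq hρ, isTwoLoopMellin hq hρ⟩, h1, h2,
    isReflectionInvariant_of_real h1 fun s _ _ => ?_,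
    isReflectionInvariant_of_real h2 fun s hs hs' => ?_, fun _ _ => rfl⟩
  · push_cast
    rw [sub_sub_cancel, mul_comm (1 - (s : ℂ))]
  · rw [twoLoopMellin, twoLoopMellin, euclTwoLoop_one_sub hs hs']
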